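/- **Setting.** A transmitter uses $K\ge 1$ parallel streams during $N$ channel uses with symbol duration $T_s>0$. At channel use $n$ the received signal of stream $k$ is $y_{k,n}=\sqrt{\lambda_{k,n}\,\sigma_{k,n}^2}\,s_{k,n}+w_{k,n}$, with gains $\lambda_{k,n}>0$, powers $\sigma^2_{k,n}\ge 0$, and independent standard Gaussian noise $w_{k,n}$. The components of $\mathbf s_n=(s_{1,n},\dots,s_{K,n})$ are independent of each other and of the noise, and $s_{k,n}$ has law $P_k$, an arbitrary probability law on $\mathbb R$ with unit power $\int x^2\,dP_k=1$ that is not a point mass. At the beginnings of the channel uses $1=e_1<e_2<\dots<e_J\le N$ ($J\ge 1$) packets of energy $E_1,\dots,E_J\ge 0$ arrive. The pool $\tau_j$ consists of the channel uses $n$ with $e_j\le n<e_{j+1}$ (with $e_{J+1}=N+1$). The problem is $$\max_{\sigma^2_{k,n}\ge 0}\ \sum_{j=1}^J\sum_{n\in\tau_j} I(\mathbf s_n;\mathbf y_n)\quad\text{subject to}\quad T_s\sum_{j=1}^{\ell}\sum_{n\in\tau_j}\sum_{k=1}^K\sigma_{k,n}^2\le\sum_{j=1}^{\ell}E_j,\qquad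 \ell=1,\dots,J ,$$ where the constraints are called the energy causality constraints (ECCs). Let $\mathrm{mmse}_k(\gamma)=\mathbb E\big[(x-\mathbb E[x\mid\sqrt\gamma\,x+w])^2\big]$ for independent $x\sim P_k$ and $w\sim\mathcal N(0,1)$, let $\mathrm{mmse}_k^{-1}(\psi)=\inf\{\gamma\ge 0:\mathrm{mmse}_k(\gamma)\le\psi\}$ for $\psi>0$, and let $G_k(\psi)=\frac1\psi-\mathrm{mmse}_k^{-1}(\psi)$ for $0<\psi\le 1$ and $G_k(\psi)=1$ for $\psi\ge1$. A water level $W>0$ gives stream $k$ at channel use $n$ the power $$p_{k,n}(W)=\Big(W-\tfrac{1}{\lambda_{k,n}}G_k\big(\tfrac1{W\lambda_{k,n}}\big)\Big)^+ .$$ The *mercury/waterfilling algorithm* (HgWFA) applied to a nonempty set $A$ of pools returns a water level $W>0$ with $T_s\sum_{j\in A}\sum_{n\in\tau_j}\sum_k p_{k,n}(W)=\sum_{j\in A}E_j$. An *epoch* is a set of consecutive pools with a common water level. *Non Decreasing water level Algorithm (NDA).* Start with the $J$ epochs $\{\tau_1\},\dots,\{\tau_J\}$, each with a level given by the HgWFA.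 While some epoch has a level strictly larger than that of the following epoch, merge two such adjacent epochs and compute the level of their union by the HgWFA. Stop when the levels do not decrease from any epoch to the following one. *Forward Search Algorithm (FSA).* Starting from the first pool, take all remaining pools as the candidate for the next epoch and apply the HgWFA to it. If at the level obtained the ECCs within the candidate epoch (with energy and consumption counted from its first pool) are not all fulfilled, remove its last pool and repeat. If they are fulfilled, accept the epoch and continue from the first pool not included in it. Stop when every pool is in some epoch. **Theorem.** The HgWFA succeeds on every nonempty set of pools: a level as required exists. Both the NDA and the FSA terminate, never get stuck, and return the optimal Mercury Water-Flowing power allocation, whichever decreasing pair of epochs the NDA merges and whichever admissible level the HgWFA returns. That is, if $W_j$ denotes the final level of the epoch that contains $\tau_j$, then the returned powers $$\sigma_{k,n}^2=\Big(W_j-\tfrac{1}{\lambda_{k,n}}G_k\big(\tfrac1{W_j\lambda_{k,n}}\big)\Big)^+,\qquad n\in\tau_j,\ 1\le k\le K,$$ satisfy all ECCs and are the unique maximizer of the problem above. Moreover there are multipliers $\rho_1,\dots,\rho_J\ge 0$ with $\sum_{\ell\ge j}\rho_\ell>0$ and $W_j=\dfrac{1}{2T_s\sum_{\ell=j}^J\rho_\ell}$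 for all $j$, and $\rho_\ell\Big(T_s\sum_{j\le\ell}\sum_{n\in\tau_j}\sum_k\sigma^2_{k,n}-\sum_{j\le\ell}E_j\Big)=0$ for all $\ell$. -/

import Mathlib

open MeasureTheory ProbabilityTheory

noncomputable section

/-! ### Mutual information and MMSE of Gaussian channels -/

/-- Mutual information (in nats) of a pair of random variables with joint law `ρ`: the
Kullback-Leibler divergence of the joint law from the product of its marginals. -/
def mutualInformation {α β : Type*} [MeasurableSpace α] [MeasurableSpace β]
    (ρ : Measure (α × β)) : ENNReal :=
  InformationTheory.klDiv ρ (ρ.fst.prod ρ.snd)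

/-- Joint law of `(s, y)` for `y k = a k * s k + w k`, where `s` has independent components
`s k ∼ P k` and `w` is an independent standard Gaussian vector. -/
def gaussianChannelLaw {K : ℕ} (P : Fin K → Measure ℝ) (a : Fin K → ℝ) :
    Measure ((Fin K → ℝ) × (Fin K → ℝ)) :=
  ((Measure.pi P).prod (Measure.pi fun _ : Fin K => gaussianReal 0 1)).map
    fun sw => (sw.1, fun k => a k * sw.1 k + sw.2 k)

/-- Minimum mean square error `E[(x - E[x | √snr x + w])²]` for estimating `x ∼ P` from
`√snr x + w`, with `w` standard Gaussian and independent of `x`. -/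
def mmse (P : Measure ℝ) (snr : ℝ) : ℝ :=
  ∫ ω, (ω.1 - ((P.prod (gaussianReal 0 1))[fun ω' : ℝ × ℝ => ω'.1 |
    MeasurableSpace.comap (fun ω' : ℝ × ℝ => Real.sqrt snr * ω'.1 + ω'.2) inferInstance]) ω) ^ 2
    ∂(P.prod (gaussianReal 0 1))

/-- Inverse MMSE function: the least signal-to-noise ratio at which the MMSE is at most `ψ`.
On `(0, mmse P 0]` it is the inverse of the strictly decreasing function `mmse P` on `[0, ∞)`,
and for `ψ ≥ mmse P 0` its value is `0`. -/
def mmseInv (P : Measure ℝ) (ψ : ℝ) : ℝ :=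
  sInf {snr : ℝ | 0 ≤ snr ∧ mmse P snr ≤ ψ}

/-- The mercury factor `G` (used for `ψ > 0`). -/
def mercuryFactor (P : Measure ℝ) (ψ : ℝ) : ℝ :=
  if ψ ≤ 1 then 1 / ψ - mmseInv P ψ else 1

/-- Power `(W - G(1 / (W g)) / g)⁺` given by the water level `W` to a stream of gain `g` and
input law `P`. -/
def mercuryPower (P : Measure ℝ) (g W : ℝ) : ℝ :=
  max (W - 1 / g * mercuryFactor P (1 / (W * g))) 0

/-! ### The energy harvesting transmitter -/

/-- `K` parallel streams, `N` channel uses, `J` energy packets (indices start at `0`). -/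
structure HarvestingSystem (K N J : ℕ) [NeZero J] where
  /-- symbol duration -/
  symbolTime : ℝ
  symbolTime_pos : 0 < symbolTime
  /-- channel gain of each stream at each channel use -/
  gain : Fin K → Fin N → ℝ
  gain_pos : ∀ k n, 0 < gain k n
  /-- law of the input symbol of each stream -/
  input : Fin K → Measure ℝ
  input_prob : ∀ k, IsProbabilityMeasure (input k)
  input_unit_power : ∀ k, ∫ x, x ^ 2 ∂(input k) = 1
  input_not_constant : ∀ k c, input k ≠ Measure.dirac c
  /-- channel use at whose beginning each packet arrives -/
  arrival : Fin J → Fin N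
  arrival_strictMono : StrictMono arrival
  arrival_first : (arrival 0 : ℕ) = 0
  /-- energy of each packet; the first one is the initial battery -/
  energy : Fin J → ℝ
  energy_nonneg : ∀ j, 0 ≤ energy j

namespace HarvestingSystem

variable {K N J : ℕ} [NeZero J] (S : HarvestingSystem K N J)

/-- The `j`-th pool: the channel uses from the `j`-th arrival until just before the next one. -/
def pool (j : Fin J) : Finset (Fin N) :=
  Finset.univ.filter fun n => S.arrival j ≤ n ∧ ∀ i, j < i → n < S.arrival i

/-- Mean energy spent in the pools `A` by the power allocation `p` (`p k n` is the power of
stream `k` at channel use `n`). -/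
def spent (p : Fin K → Fin N → ℝ) (A : Finset (Fin J)) : ℝ :=
  S.symbolTime * ∑ j ∈ A, ∑ n ∈ S.pool j, ∑ k, p k n

/-- Energy harvested in the pools `A`. -/
def harvested (A : Finset (Fin J)) : ℝ :=
  ∑ j ∈ A, S.energy j

/-- Nonnegative powers that satisfy all energy causality constraints. -/
def Feasible (p : Fin K → Fin N → ℝ) : Prop :=
  (∀ k n, 0 ≤ p k n) ∧ ∀ l, S.spent p (Finset.Iic l) ≤ S.harvested (Finset.Iic l)

/-- Total mutual information between the symbols `s_n` and the received signals
`y_{k,n} = √(λ_{k,n} p_{k,n}) s_{k,n} + w_{k,n}`. -/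
def throughput (p : Fin K → Fin N → ℝ) : ENNReal :=
  ∑ j, ∑ n ∈ S.pool j,
    mutualInformation (gaussianChannelLaw S.input fun k => Real.sqrt (S.gain k n * p k n))

/-- `p` solves the throughput maximization problem. -/
def IsOptimal (p : Fin K → Fin N → ℝ) : Prop :=
  S.Feasible p ∧ ∀ q, S.Feasible q → S.throughput q ≤ S.throughput p

/-- `p` is the mercury water-flowing allocation with pool water levels `W`: these levels come from
multipliers `ρ` of the energy causality constraints that are nonnegative and satisfy complementary
slackness. -/
def IsMercuryWaterFlowing (W : Fin J → ℝ) (p : Fin K → Fin N → ℝ) : Prop :=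
  (∃ ρ : Fin J → ℝ,
    (∀ l, 0 ≤ ρ l) ∧
    (∀ l, ρ l * (S.spent p (Finset.Iic l) - S.harvested (Finset.Iic l)) = 0) ∧
    (∀ j, 0 < ∑ l ∈ Finset.Ici j, ρ l) ∧
    ∀ j, W j = 1 / (2 * S.symbolTime * ∑ l ∈ Finset.Ici j, ρ l)) ∧
  ∀ j, ∀ n ∈ S.pool j, ∀ k, p k n = mercuryPower (S.input k) (S.gain k n) (W j)

/-! ### The two algorithms -/

/-- The allocation in which all channel uses have the water level `W`. -/
def levelPower (W : ℝ) : Fin K → Fin N → ℝ :=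
  fun k n => mercuryPower (S.input k) (S.gain k n) W

/-- `W` is a result of the mercury/waterfilling algorithm on the pools `A`: at the level `W` the
energy spent in these pools equals the energy harvested in them. -/
def IsWaterLevel (A : Finset (Fin J)) (W : ℝ) : Prop :=
  0 < W ∧ S.spent (S.levelPower W) A = S.harvested A

end HarvestingSystem

/-- An epoch: a set of pools together with their common water level. -/
structure Epoch (J : ℕ) where
  pools : Finset (Fin J)
  level : ℝ

/-- The water level of the pool `j` under a list of epochs. -/
def poolLevel {J : ℕ} (s : List (Epoch J)) (j : Fin J) : ℝ :=
  ((s.find? fun e => decide (j ∈ e.pools)).map Epoch.level).getD 0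

namespace HarvestingSystem

variable {K N J : ℕ} [NeZero J] (S : HarvestingSystem K N J)

theorem arrivals_nonempty (n : Fin N) :
    (Finset.univ.filter fun j => S.arrival j ≤ n).Nonempty := by
  refine ⟨0, ?_⟩
  simp only [Finset.mem_filter, Finset.mem_univ, true_and, Fin.le_def, S.arrival_first]
  exact Nat.zero_le _

/-- The pool that contains the channel use `n`: that of the last arrival up to `n`. -/
def poolOf (n : Fin N) : Fin J :=
  (Finset.univ.filter fun j => S.arrival j ≤ n).max' (S.arrivals_nonempty n)

/-- The power allocation in which every channel use has the water level of its epoch. -/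
def allocation (s : List (Epoch J)) : Fin K → Fin N → ℝ :=
  fun k n => mercuryPower (S.input k) (S.gain k n) (poolLevel s (S.poolOf n))

/-- Initial states of the non-decreasing water level algorithm: every epoch is one pool, and the
mercury/waterfilling algorithm has been performed on every epoch. -/
def NDAStart (s : List (Epoch J)) : Prop :=
  s.map Epoch.pools = (List.finRange J).map (fun j => {j}) ∧
    ∀ e ∈ s, S.IsWaterLevel e.pools e.level

/-- One step of the non-decreasing water level algorithm: some epoch whose level exceeds that of
the following epoch is merged with it, and the mercury/waterfilling algorithm gives the level of
the union. -/
def NDAStep (s t : List (Epoch J)) : Prop :=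
  ∃ (l r : List (Epoch J)) (a b c : Epoch J),
    s = l ++ a :: b :: r ∧ b.level < a.level ∧
    c.pools = a.pools ∪ b.pools ∧ S.IsWaterLevel c.pools c.level ∧
    t = l ++ c :: r

end HarvestingSystem

/-- The non-decreasing water level algorithm stops if the level never decreases from one epoch to
the following one. -/
def NDAHalted {J : ℕ} (s : List (Epoch J)) : Prop :=
  ∀ (l r : List (Epoch J)) (a b : Epoch J), s = l ++ a :: b :: r → a.level ≤ b.level

/-- State of the forward search algorithm: the epochs found so far, and the candidate for the next
epoch, which consists of the pools `j` with `first ≤ j < upper`. -/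
structure FSAState (J : ℕ) where
  found : List (Epoch J)
  first : ℕ
  upper : ℕ

/-- The pools of the candidate epoch. -/
def FSAState.candidate {J : ℕ} (s : FSAState J) : Finset (Fin J) :=
  Finset.univ.filter fun j => s.first ≤ (j : ℕ) ∧ (j : ℕ) < s.upper

/-- The first candidate epoch contains all the pools. -/
def FSAStart {J : ℕ} (s : FSAState J) : Prop :=
  s = ⟨[], 0, J⟩

/-- The forward search algorithm stops when all pools are in some epoch. -/
def FSAHalted {J : ℕ} (s : FSAState J) : Prop :=
  s.first = J

namespace HarvestingSystem

variable {K N J : ℕ} [NeZero J] (S : HarvestingSystem K N J)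

/-- The energy causality constraints within the epoch `A` hold at the water level `W`. -/
def SatisfiesECCWithin (A : Finset (Fin J)) (W : ℝ) : Prop :=
  ∀ l ∈ A, S.spent (S.levelPower W) (A.filter (· ≤ l)) ≤ S.harvested (A.filter (· ≤ l))

/-- One step of the forward search algorithm. The mercury/waterfilling algorithm is performed on the
candidate epoch. If the constraints within it fail, its last pool is removed. If they
hold, the epoch is accepted, the next epoch starts at the first pool not included in it, and the
next candidate contains all the remaining pools. -/
def FSAStep (s t : FSAState J) : Prop :=
  s.first < s.upper ∧ ∃ W, S.IsWaterLevel s.candidate W ∧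
    ((¬ S.SatisfiesECCWithin s.candidate W ∧ t = ⟨s.found, s.first, s.upper - 1⟩) ∨
      (S.SatisfiesECCWithin s.candidate W ∧ t = ⟨s.found ++ [⟨s.candidate, W⟩], s.upper, J⟩))

end HarvestingSystem

/-- Total correctness of a (nondeterministic) algorithm: it can start, no run is infinite, no run
gets stuck before the algorithm halts, and `post` holds in every state in which it halts. -/
def TotallyCorrect {α : Type*} (start : α → Prop) (step : α → α → Prop) (halted post : α → Prop) :
    Prop :=
  (∃ s, start s) ∧
  (∀ f : ℕ → α, start (f 0) → ¬ ∀ i, step (f i) (f (i + 1))) ∧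
  ∀ s₀ s, start s₀ → Relation.ReflTransGen step s₀ s →
    (halted s → post s) ∧ (¬ halted s → ∃ t, step s t)

namespace HarvestingSystem

variable {K N J : ℕ} [NeZero J] (S : HarvestingSystem K N J)

/-- The epochs `s` yield the mercury water-flowing allocation, and it is the unique solution of the
throughput maximization problem. -/
def YieldsOptimum (s : List (Epoch J)) : Prop :=
  S.IsMercuryWaterFlowing (poolLevel s) (S.allocation s) ∧
  S.IsOptimal (S.allocation s) ∧
  ∀ q, S.IsOptimal q → q = S.allocation s

end HarvestingSystem

end

/-!
Substituting the inverse MMSE function into the mercury factor turns the power of a stream of gain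
`g` at the level `W` into `mmseInv (1 / (W g)) / g` (`mercuryPower_eq`). Two facts about scalar
Gaussian channels make this power optimal at the price `1 / (2 W)`.

* The I-MMSE relation, `hasDerivAt_scalarInfo`: as a function of the amplitude `a = √snr`, the
  mutual information of `y = a x + w` has the derivative `a * mmse (a ^ 2)`. It is obtained by
  differentiating the logarithm of the marginal likelihood of `a x + w` for fixed `(x, w)`.
  The tower property of posterior means, `integrable_and_integral_posteriorMean`, evaluates the
  expected derivative.
  Domination needs no more than second moments of the input, since
  `a ^ 2 * E[x ^ 2 | y] ≤ 6 y ^ 2 + 4 a ^ 2` (`sq_mul_posteriorMean_sq_le`).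
* The MMSE is strictly decreasing, `meanSquareError_strictAnti`: the output at a smaller amplitude
  is a degraded version of the output at a larger one, and the error increases by the mean square
  difference of the two conditional mean estimates. If this difference vanished, then the estimate
  would ignore the output, and the input would be constant.

Hence `mmseInv ψ` is the strict maximizer of the information minus `ψ / 2` times the signal-to-noise
ratio (`scalarInfo_sqrt_sub_lt`). The informations of parallel channels add up
(`mutualInformation_gaussianChannelLaw`), so Lagrange duality shows that a feasible mercury
water-flowing allocation is the unique optimum (`totalInfo_lt_of_isMercuryWaterFlowing`).

The powers are continuous and nondecreasing in the level, vanish at low levels and are unbounded,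
which gives water levels by the intermediate value theorem (`exists_isWaterLevel`). Both algorithms
produce consecutive epochs within which the energy causality constraints hold, and whose levels do
not decrease; `yieldsOptimum_of_consecutive` reads off the multipliers from the drops of the inverse
level. For the non-decreasing water level algorithm, the constraints within epochs are an invariant,
because merging two epochs of decreasing levels keeps them (`SatisfiesECCWithin.merge`). For the
forward search algorithm, the same lemma shows that a decrease of the level would contradict the
rejection of the union of the two epochs (`ndaHalted_of_noLongerEpoch`). A water level is unique
only where energy is spent, but all water levels of an epoch yield the same powers on it
(`IsWaterLevel.spent_le`), so no choice matters.
-/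

set_option linter.unusedSectionVars false

/-! ### Posterior averages in a scalar Gaussian channel -/

/-- The Gaussian likelihood, up to the factor `1 / √(2π)`, of the output `y` of the channel
`y = a x + w` given the input `x`. -/
noncomputable def likelihood (a x y : ℝ) : ℝ := Real.exp (-(y - a * x) ^ 2 / 2)

/-- The integral of `h` over the input law `P`, weighted by the likelihood of the output `y`. -/
noncomputable def weighted (P : Measure ℝ) (a : ℝ) (h : ℝ → ℝ) (y : ℝ) : ℝ :=
  ∫ x, h x * likelihood a x y ∂P

/-- The marginal likelihood of the output `y`, up to the factor `1 / √(2π)`. -/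
noncomputable def evidence (P : Measure ℝ) (a y : ℝ) : ℝ := ∫ x, likelihood a x y ∂P

/-- The posterior mean of `h x` given the output `y`, by Bayes' formula. -/
noncomputable def posteriorMean (P : Measure ℝ) (a : ℝ) (h : ℝ → ℝ) (y : ℝ) : ℝ :=
  weighted P a h y / evidence P a y

/-- The joint law of input and output of the scalar channel `y = a x + w`. -/
noncomputable def scalarLaw (P : Measure ℝ) (a : ℝ) : Measure (ℝ × ℝ) :=
  (P.prod (gaussianReal 0 1)).map fun ω => (ω.1, a * ω.1 + ω.2)

theorem likelihood_pos (a x y : ℝ) : 0 < likelihood a x y := Real.exp_pos _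

theorem likelihood_le_one (a x y : ℝ) : likelihood a x y ≤ 1 :=
  Real.exp_le_one_iff.2 (by nlinarith [sq_nonneg (y - a * x)])

theorem continuous_likelihood : Continuous fun p : ℝ × ℝ × ℝ => likelihood p.1 p.2.1 p.2.2 := by
  unfold likelihood; fun_prop

theorem measurable_likelihood (a y : ℝ) : Measurable fun x => likelihood a x y := by
  unfold likelihood; fun_prop

section

variable {P : Measure ℝ} {h : ℝ → ℝ}

theorem Integrable.mul_likelihood (hh : Integrable h P) (a y : ℝ) :
    Integrable (fun x => h x * likelihood a x y) P :=
  hh.mul_bdd (c := 1) (measurable_likelihood a y).aestronglyMeasurable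
    (Filter.Eventually.of_forall fun x => by
      rw [Real.norm_eq_abs, abs_of_pos (likelihood_pos _ _ _)]; exact likelihood_le_one _ _ _)

theorem continuous_weighted (hh : Integrable h P) (a : ℝ) : Continuous (weighted P a h) := by
  refine continuous_of_dominated (bound := fun x => ‖h x‖)
    (fun y => (Integrable.mul_likelihood hh a y).aestronglyMeasurable) (fun y => ?_) hh.norm ?_
  · refine Filter.Eventually.of_forall fun x => ?_
    rw [norm_mul, Real.norm_eq_abs (likelihood _ _ _), abs_of_pos (likelihood_pos _ _ _)]
    exact mul_le_of_le_one_right (norm_nonneg _) (likelihood_le_one _ _ _)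
  · refine Filter.Eventually.of_forall fun x => ?_
    unfold likelihood; fun_prop

theorem evidence_eq_weighted (a : ℝ) : evidence P a = weighted P a fun _ => 1 := by
  ext y; simp [evidence, weighted]

variable [IsProbabilityMeasure P]

theorem integrable_likelihood (a y : ℝ) : Integrable (fun x => likelihood a x y) P := by
  simpa using Integrable.mul_likelihood (integrable_const (1 : ℝ) (μ := P)) a y

theorem evidence_pos (a y : ℝ) : 0 < evidence P a y := by
  rw [evidence, integral_pos_iff_support_of_nonneg (fun x => (likelihood_pos a x y).le)
    (integrable_likelihood a y)]
  have : Function.support (fun x => likelihood a x y) = Set.univ := by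
    ext x; simp [(likelihood_pos a x y).ne']
  rw [this]; simp

theorem evidence_le_one (a y : ℝ) : evidence P a y ≤ 1 := by
  have := integral_mono (μ := P) (integrable_likelihood a y) (integrable_const 1)
    (fun x => likelihood_le_one a x y)
  simpa [evidence] using this

theorem continuous_evidence (a : ℝ) : Continuous (evidence P a) := by
  rw [evidence_eq_weighted]; exact continuous_weighted (integrable_const 1) a

theorem continuous_posteriorMean (hh : Integrable h P) (a : ℝ) : Continuous (posteriorMean P a h) :=
  (continuous_weighted hh a).div (continuous_evidence a) fun y => (evidence_pos a y).ne'

instance (a : ℝ) : IsProbabilityMeasure (scalarLaw P a) :=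
  Measure.isProbabilityMeasure_map (by fun_prop)

theorem fst_scalarLaw (a : ℝ) : (scalarLaw P a).fst = P := by
  rw [scalarLaw, Measure.fst, Measure.map_map measurable_fst (by fun_prop)]
  exact Measure.map_fst_prod.trans (by simp)

/-- The joint law has the Gaussian likelihood as density with respect to the product of the input
law and Lebesgue measure. -/
theorem lintegral_scalarLaw (a : ℝ) {f : ℝ × ℝ → ENNReal} (hf : Measurable f) :
    ∫⁻ z, f z ∂(scalarLaw P a) =
      ∫⁻ y, ∫⁻ x, f (x, y) * ENNReal.ofReal ((√(2 * Real.pi))⁻¹ * likelihood a x y) ∂P := by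
  rw [scalarLaw, lintegral_map hf (by fun_prop), lintegral_prod _ (by fun_prop)]
  rw [lintegral_lintegral_swap (f := fun y x => f (x, y) *
    ENNReal.ofReal ((√(2 * Real.pi))⁻¹ * likelihood a x y))]
  · refine lintegral_congr fun x => ?_
    rw [gaussianReal_of_var_ne_zero _ one_ne_zero,
      lintegral_withDensity_eq_lintegral_mul _ (by fun_prop) (by fun_prop),
      ← lintegral_sub_right_eq_self _ (a * x)]
    refine lintegral_congr fun y => ?_
    simp only [Pi.mul_apply, gaussianPDF, gaussianPDFReal, likelihood]
    rw [mul_comm]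
    simp
  · refine Measurable.aemeasurable ?_
    have := (continuous_likelihood.comp (f := fun p : ℝ × ℝ => (a, p.2, p.1))
      (by fun_prop)).measurable
    simp only [Function.comp_def] at this
    have h2 : Measurable fun p : ℝ × ℝ => f (p.2, p.1) := by fun_prop
    exact h2.mul (this.const_mul _).ennreal_ofReal

theorem snd_scalarLaw (a : ℝ) : (scalarLaw P a).snd =
    volume.withDensity fun y => ENNReal.ofReal ((√(2 * Real.pi))⁻¹ * evidence P a y) := by
  ext s hs
  rw [withDensity_apply _ hs, Measure.snd_apply hs,
    ← lintegral_indicator_one (measurable_snd hs),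
    lintegral_scalarLaw _ (measurable_one.indicator (measurable_snd hs)),
    ← lintegral_indicator hs]
  refine lintegral_congr fun y => ?_
  by_cases hy : y ∈ s
  · simp only [Set.indicator, Set.mem_preimage, hy, if_true, Pi.one_apply, one_mul]
    rw [← ofReal_integral_eq_lintegral_ofReal ((integrable_likelihood a y).const_mul _)
      (Filter.Eventually.of_forall fun x => by have := likelihood_pos a x y; positivity),
      integral_const_mul, evidence]
  · simp [Set.indicator, hy]

/-- The likelihood ratio of the joint law of input and output with respect to the product of the
marginal laws. -/
noncomputable def likelihoodRatio (P : Measure ℝ) (a : ℝ) (z : ℝ × ℝ) : ℝ :=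
  likelihood a z.1 z.2 / evidence P a z.2

theorem likelihoodRatio_pos (a : ℝ) (z : ℝ × ℝ) : 0 < likelihoodRatio P a z :=
  div_pos (likelihood_pos _ _ _) (evidence_pos _ _)

theorem continuous_likelihoodRatio (a : ℝ) : Continuous (likelihoodRatio P a) := by
  refine Continuous.div ?_ ((continuous_evidence a).comp continuous_snd)
    fun z => (evidence_pos a z.2).ne'
  exact continuous_likelihood.comp (f := fun p : ℝ × ℝ => (a, p.1, p.2)) (by fun_prop)

theorem scalarLaw_eq_withDensity (a : ℝ) : scalarLaw P a =
    (P.prod (scalarLaw P a).snd).withDensity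
      fun z => ENNReal.ofReal (likelihoodRatio P a z) := by
  have hm : Measurable fun z => ENNReal.ofReal (likelihoodRatio P a z) :=
    (continuous_likelihoodRatio a).measurable.ennreal_ofReal
  have he : Measurable fun y => ENNReal.ofReal ((√(2 * Real.pi))⁻¹ * evidence P a y) :=
    ((continuous_evidence a).measurable.const_mul _).ennreal_ofReal
  ext s hs
  have hi : Measurable (s.indicator fun z => ENNReal.ofReal (likelihoodRatio P a z)) :=
    hm.indicator hs
  rw [withDensity_apply _ hs, ← lintegral_indicator_one hs,
    lintegral_scalarLaw _ (measurable_one.indicator hs), ← lintegral_indicator hs,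
    lintegral_prod_symm' _ hi, snd_scalarLaw,
    lintegral_withDensity_eq_lintegral_mul _ he hi.lintegral_prod_left']
  refine lintegral_congr fun y => ?_
  have hy : Measurable fun x =>
      s.indicator (fun z => ENNReal.ofReal (likelihoodRatio P a z)) (x, y) :=
    hi.comp measurable_prodMk_right
  rw [Pi.mul_apply, ← lintegral_const_mul _ hy]
  refine lintegral_congr fun x => ?_
  by_cases hx : (x, y) ∈ s
  · simp only [Set.indicator, hx, if_true, Pi.one_apply, one_mul]
    rw [← ENNReal.ofReal_mul (by have := (evidence_pos (P := P) a y).le; positivity),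
      likelihoodRatio]
    congr 1
    have := (evidence_pos (P := P) a y).ne'
    field_simp
  · simp [Set.indicator, hx]

end

section

variable {P : Measure ℝ} [IsProbabilityMeasure P]

theorem integral_likelihoodRatio_mul (a : ℝ) (h : ℝ → ℝ) (y : ℝ) :
    ∫ x, likelihoodRatio P a (x, y) * h x ∂P = posteriorMean P a h y := by
  rw [posteriorMean, weighted, ← integral_div]
  congr 1; ext x; simp only [likelihoodRatio]; ring

/-- The tower property: averaging the posterior mean of `h` over the outputs gives the mean of
`h`. -/
theorem integrable_and_integral_posteriorMean {a : ℝ} {h : ℝ × ℝ → ℝ}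
    (hh : Integrable h (scalarLaw P a)) :
    Integrable (fun z => posteriorMean P a (fun x => h (x, z.2)) z.2) (scalarLaw P a) ∧
      ∫ z, posteriorMean P a (fun x => h (x, z.2)) z.2 ∂(scalarLaw P a) =
        ∫ z, h z ∂(scalarLaw P a) := by
  have hm : Measurable fun z => ENNReal.ofReal (likelihoodRatio P a z) :=
    (continuous_likelihoodRatio a).measurable.ennreal_ofReal
  have hr : ∀ z, (ENNReal.ofReal (likelihoodRatio P a z)).toReal = likelihoodRatio P a z :=
    fun z => ENNReal.toReal_ofReal (likelihoodRatio_pos a z).le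
  have hi : Integrable (fun z => likelihoodRatio P a z * h z) (P.prod (scalarLaw P a).snd) := by
    rw [scalarLaw_eq_withDensity, integrable_withDensity_iff_integrable_smul' hm
      (Filter.Eventually.of_forall fun z => ENNReal.ofReal_lt_top)] at hh
    simpa only [hr, smul_eq_mul] using hh
  have hp : Integrable (fun y => posteriorMean P a (fun x => h (x, y)) y) (scalarLaw P a).snd := by
    simpa only [integral_likelihoodRatio_mul] using hi.integral_prod_right
  refine ⟨hp.comp_measurable measurable_snd, ?_⟩
  rw [← integral_map (φ := Prod.snd) (f := fun y => posteriorMean P a (fun x => h (x, y)) y)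
    measurable_snd.aemeasurable hp.aestronglyMeasurable]
  conv_rhs => rw [scalarLaw_eq_withDensity, integral_withDensity_eq_integral_toReal_smul hm
      (Filter.Eventually.of_forall fun z => ENNReal.ofReal_lt_top)]
  simp only [hr, smul_eq_mul]
  rw [integral_prod_symm _ hi]
  simp only [integral_likelihoodRatio_mul]
  rfl

theorem posteriorMean_mono {h k : ℝ → ℝ} (hh : Integrable h P) (hk : Integrable k P)
    (hle : ∀ x, h x ≤ k x) (a y : ℝ) : posteriorMean P a h y ≤ posteriorMean P a k y :=
  div_le_div_of_nonneg_right
    (integral_mono (Integrable.mul_likelihood hh a y) (Integrable.mul_likelihood hk a y)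
      fun x => mul_le_mul_of_nonneg_right (hle x) (likelihood_pos a x y).le)
    (evidence_pos a y).le

theorem integrable_sq_of_unit_power (hP : ∫ x, x ^ 2 ∂P = 1) : Integrable (fun x => x ^ 2) P :=
  integrable_of_integral_eq_one hP

theorem memLp_two_of_unit_power (hP : ∫ x, x ^ 2 ∂P = 1) : MemLp (fun x : ℝ => x) 2 P :=
  (memLp_two_iff_integrable_sq measurable_id.aestronglyMeasurable).2
    (integrable_sq_of_unit_power hP)

theorem integrable_id_of_unit_power (hP : ∫ x, x ^ 2 ∂P = 1) : Integrable (fun x : ℝ => x) P :=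
  (memLp_two_of_unit_power hP).integrable (by norm_num)

theorem posteriorMean_quadratic (hP : ∫ x, x ^ 2 ∂P = 1) (a α β γ y : ℝ) :
    posteriorMean P a (fun x => α * x ^ 2 + β * x + γ) y =
      α * posteriorMean P a (fun x => x ^ 2) y + β * posteriorMean P a (fun x => x) y + γ := by
  have h2 := Integrable.mul_likelihood (integrable_sq_of_unit_power hP) a y
  have h1 := Integrable.mul_likelihood (integrable_id_of_unit_power hP) a y
  have h0 := integrable_likelihood (P := P) a y
  have he := (evidence_pos (P := P) a y).ne'
  have : weighted P a (fun x => α * x ^ 2 + β * x + γ) y =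
      α * weighted P a (fun x => x ^ 2) y + β * weighted P a (fun x => x) y
        + γ * evidence P a y := by
    simp only [weighted, evidence]
    rw [← integral_const_mul, ← integral_const_mul, ← integral_const_mul, ← integral_add,
      ← integral_add]
    · congr 1; ext x; ring
    · exact (h2.const_mul _).add (h1.const_mul _)
    · exact h0.const_mul _
    · exact h2.const_mul _
    · exact h1.const_mul _
  simp only [posteriorMean, this]
  field_simp

theorem sq_posteriorMean_le (hP : ∫ x, x ^ 2 ∂P = 1) (a y : ℝ) :
    posteriorMean P a (fun x => x) y ^ 2 ≤ posteriorMean P a (fun x => x ^ 2) y := by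
  set c := posteriorMean P a (fun x => x) y with hc
  have h := posteriorMean_quadratic hP a 1 (-2 * c) (c ^ 2) y
  have h0 : 0 ≤ posteriorMean P a (fun x => 1 * x ^ 2 + -2 * c * x + c ^ 2) y := by
    refine div_nonneg (integral_nonneg fun x => ?_) (evidence_pos a y).le
    exact mul_nonneg (by nlinarith [sq_nonneg (x - c)]) (likelihood_pos a x y).le
  rw [h, ← hc] at h0
  nlinarith

theorem integrable_sq_residual (hP : ∫ x, x ^ 2 ∂P = 1) (a y : ℝ) :
    Integrable (fun x => (y - a * x) ^ 2) P :=
  ((memLp_const y).sub ((memLp_two_of_unit_power hP).const_mul a)).integrable_sq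

theorem integral_sq_residual_le (hP : ∫ x, x ^ 2 ∂P = 1) (a y : ℝ) :
    ∫ x, (y - a * x) ^ 2 ∂P ≤ 2 * y ^ 2 + 2 * a ^ 2 := by
  have h2 := integrable_sq_of_unit_power hP
  have : ∫ x, (2 * y ^ 2 + 2 * a ^ 2 * x ^ 2) ∂P = 2 * y ^ 2 + 2 * a ^ 2 := by
    rw [integral_add (integrable_const _) (h2.const_mul _), integral_const_mul (2 * a ^ 2), hP]
    simp
  rw [← this]
  exact integral_mono (integrable_sq_residual hP a y) ((integrable_const _).add (h2.const_mul _))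
    fun x => by nlinarith [sq_nonneg (y + a * x)]

/-- The posterior expectation of the squared residual is at most its prior expectation: the
likelihood is a decreasing function of the squared residual. -/
theorem posteriorMean_sq_residual_le (hP : ∫ x, x ^ 2 ∂P = 1) (a y : ℝ) :
    posteriorMean P a (fun x => (y - a * x) ^ 2) y ≤ ∫ x, (y - a * x) ^ 2 ∂P := by
  set m := ∫ x, (y - a * x) ^ 2 ∂P with hm
  have hq := integrable_sq_residual hP a y
  have h1 := Integrable.mul_likelihood hq a y
  have h0 := integrable_likelihood (P := P) a y
  rw [posteriorMean, div_le_iff₀ (evidence_pos a y), weighted, evidence, ← integral_const_mul,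
    ← sub_nonneg, ← integral_sub (h0.const_mul m) h1]
  have hz : ∫ x, Real.exp (-m / 2) * (m - (y - a * x) ^ 2) ∂P = 0 := by
    rw [integral_const_mul, integral_sub (integrable_const _) hq, ← hm]; simp
  rw [← hz]
  refine integral_mono (((integrable_const _).sub hq).const_mul _) ((h0.const_mul m).sub h1)
    fun x => ?_
  simp only [likelihood]
  rcases le_total m ((y - a * x) ^ 2) with h | h
  · have : Real.exp (-(y - a * x) ^ 2 / 2) ≤ Real.exp (-m / 2) := Real.exp_le_exp.2 (by linarith)
    nlinarith
  · have : Real.exp (-m / 2) ≤ Real.exp (-(y - a * x) ^ 2 / 2) := Real.exp_le_exp.2 (by linarith)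
    nlinarith

/-- A bound on the posterior second moment that is quadratic in the output, so that it is integrable
whenever the input has a second moment. -/
theorem sq_mul_posteriorMean_sq_le (hP : ∫ x, x ^ 2 ∂P = 1) (a y : ℝ) :
    a ^ 2 * posteriorMean P a (fun x => x ^ 2) y ≤ 6 * y ^ 2 + 4 * a ^ 2 := by
  have h := (posteriorMean_sq_residual_le hP a y).trans (integral_sq_residual_le hP a y)
  have e : (fun x => (y - a * x) ^ 2) = fun x => a ^ 2 * x ^ 2 + (-2 * a * y) * x + y ^ 2 := by
    ext x; ring
  have hle : posteriorMean P a (fun x => a ^ 2 * x ^ 2 + 0 * x + 0) y ≤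
      posteriorMean P a (fun x => 2 * a ^ 2 * x ^ 2 + (-4 * a * y) * x + 4 * y ^ 2) y := by
    have h2 := integrable_sq_of_unit_power hP
    have h1 := integrable_id_of_unit_power hP
    refine posteriorMean_mono (((h2.const_mul _).add (h1.const_mul _)).add (integrable_const _))
      (((h2.const_mul _).add (h1.const_mul _)).add (integrable_const _)) (fun x => ?_) a y
    simp only [Pi.add_apply]
    nlinarith [sq_nonneg (a * x - 2 * y)]
  rw [e, posteriorMean_quadratic hP] at h
  rw [posteriorMean_quadratic hP, posteriorMean_quadratic hP] at hle
  linarith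

/-- By Jensen's inequality, minus the logarithm of the evidence is at most half of the mean squared
residual. -/
theorem neg_log_evidence_le (hP : ∫ x, x ^ 2 ∂P = 1) (a y : ℝ) :
    -Real.log (evidence P a y) ≤ y ^ 2 + a ^ 2 := by
  set m := ∫ x, (y - a * x) ^ 2 ∂P with hm
  have hq := integrable_sq_residual hP a y
  have hi : Integrable (fun x => 1 / 2 * (m - (y - a * x) ^ 2)) P :=
    ((integrable_const m).sub hq).const_mul _
  have h : Real.exp (-m / 2) ≤ evidence P a y := by
    have hz : ∫ x, Real.exp (-m / 2) * (1 + (1 / 2) * (m - (y - a * x) ^ 2)) ∂P =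
        Real.exp (-m / 2) := by
      rw [integral_const_mul, integral_add (integrable_const _) hi, integral_const_mul,
        integral_sub (integrable_const _) hq, ← hm]
      simp
    rw [← hz]
    refine integral_mono (((integrable_const _).add hi).const_mul _) (integrable_likelihood a y)
      fun x => ?_
    have h1 := Real.add_one_le_exp ((1 / 2) * (m - (y - a * x) ^ 2))
    have h2 : likelihood a x y =
        Real.exp (-m / 2) * Real.exp ((1 / 2) * (m - (y - a * x) ^ 2)) := by
      rw [likelihood, ← Real.exp_add]; congr 1; ring
    rw [h2]
    exact mul_le_mul_of_nonneg_left (by linarith) (Real.exp_pos _).le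
  have h3 := (Real.le_log_iff_exp_le (evidence_pos a y)).2 h
  have := integral_sq_residual_le hP a y
  linarith

theorem log_evidence_nonpos (a y : ℝ) : Real.log (evidence P a y) ≤ 0 :=
  Real.log_nonpos (evidence_pos a y).le (evidence_le_one a y)

end

/-! ### The minimum mean square error -/

/-- The conditional mean estimate of the input of the scalar channel from its output `y`. -/
noncomputable def estimate (P : Measure ℝ) (a y : ℝ) : ℝ := posteriorMean P a (fun x => x) y

/-- The mean square error of the conditional mean estimate, as a function of the amplitude `a`. -/
noncomputable def meanSquareError (P : Measure ℝ) (a : ℝ) : ℝ :=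
  ∫ z, (z.1 - estimate P a z.2) ^ 2 ∂(scalarLaw P a)

theorem memLp_two_noise : MemLp (fun x : ℝ => x) 2 (gaussianReal 0 1) :=
  memLp_id_gaussianReal 2

theorem integral_sq_noise : ∫ x, x ^ 2 ∂(gaussianReal 0 1) = 1 := by
  have h := variance_fun_id_gaussianReal (μ := 0) (v := 1)
  rw [variance_of_integral_eq_zero (by fun_prop) (by simp)] at h
  simpa using h

section

variable {P : Measure ℝ} [IsProbabilityMeasure P]

theorem continuous_estimate (hP : ∫ x, x ^ 2 ∂P = 1) (a : ℝ) : Continuous (estimate P a) :=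
  continuous_posteriorMean (integrable_id_of_unit_power hP) a

theorem integrable_scalarLaw_iff (a : ℝ) {f : ℝ × ℝ → ℝ} (hf : Measurable f) :
    Integrable f (scalarLaw P a) ↔
      Integrable (fun ω : ℝ × ℝ => f (ω.1, a * ω.1 + ω.2)) (P.prod (gaussianReal 0 1)) :=
  integrable_map_measure hf.aestronglyMeasurable (by fun_prop)

theorem integral_scalarLaw (a : ℝ) {f : ℝ × ℝ → ℝ} (hf : Measurable f) :
    ∫ z, f z ∂(scalarLaw P a) =
      ∫ ω : ℝ × ℝ, f (ω.1, a * ω.1 + ω.2) ∂(P.prod (gaussianReal 0 1)) :=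
  integral_map (by fun_prop) hf.aestronglyMeasurable

theorem memLp_input (hP : ∫ x, x ^ 2 ∂P = 1) (a : ℝ) :
    MemLp (fun z : ℝ × ℝ => z.1) 2 (scalarLaw P a) := by
  have h := memLp_two_of_unit_power hP
  rw [← fst_scalarLaw (P := P) a] at h
  exact (memLp_map_measure_iff measurable_id.aestronglyMeasurable measurable_fst.aemeasurable).1 h

theorem integral_sq_input (hP : ∫ x, x ^ 2 ∂P = 1) (a : ℝ) :
    ∫ z : ℝ × ℝ, z.1 ^ 2 ∂(scalarLaw P a) = 1 := by
  rw [← integral_map (φ := Prod.fst) (f := fun x : ℝ => x ^ 2) measurable_fst.aemeasurable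
    (by fun_prop)]
  exact (congrArg (fun μ => ∫ x, x ^ 2 ∂μ) (fst_scalarLaw a)).trans hP

theorem integrable_posteriorMean_sq (hP : ∫ x, x ^ 2 ∂P = 1) (a : ℝ) :
    Integrable (fun z => posteriorMean P a (fun x => x ^ 2) z.2) (scalarLaw P a) ∧
      ∫ z, posteriorMean P a (fun x => x ^ 2) z.2 ∂(scalarLaw P a) = 1 := by
  have h := integrable_and_integral_posteriorMean (memLp_input hP a).integrable_sq
  exact ⟨h.1, h.2.trans (integral_sq_input hP a)⟩

theorem memLp_estimate (hP : ∫ x, x ^ 2 ∂P = 1) (a : ℝ) :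
    MemLp (fun z : ℝ × ℝ => estimate P a z.2) 2 (scalarLaw P a) := by
  have hc : Continuous fun z : ℝ × ℝ => estimate P a z.2 :=
    (continuous_estimate hP a).comp continuous_snd
  rw [memLp_two_iff_integrable_sq hc.aestronglyMeasurable]
  refine (integrable_posteriorMean_sq hP a).1.mono' (hc.pow 2).aestronglyMeasurable
    (Filter.Eventually.of_forall fun z => ?_)
  rw [Real.norm_eq_abs, abs_of_nonneg (sq_nonneg _)]
  exact sq_posteriorMean_le hP a z.2

/-- The conditional mean estimate is the orthogonal projection of the input. -/
theorem integral_estimate_mul (hP : ∫ x, x ^ 2 ∂P = 1) {a : ℝ} {g : ℝ → ℝ}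
    (hg : MemLp (fun z : ℝ × ℝ => g z.2) 2 (scalarLaw P a)) :
    ∫ z, estimate P a z.2 * g z.2 ∂(scalarLaw P a) = ∫ z, z.1 * g z.2 ∂(scalarLaw P a) := by
  have hi : Integrable (fun z : ℝ × ℝ => z.1 * g z.2) (scalarLaw P a) :=
    (memLp_input hP a).integrable_mul hg
  rw [← (integrable_and_integral_posteriorMean hi).2]
  congr 1; ext z
  simp only [estimate, posteriorMean, weighted]
  rw [div_mul_eq_mul_div, ← integral_mul_const]
  congr 2; ext x; ring

/-- Pythagoras: the error of an arbitrary estimator of the input. -/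
theorem integral_sq_sub_eq (hP : ∫ x, x ^ 2 ∂P = 1) {a : ℝ} {g : ℝ → ℝ}
    (hg : MemLp (fun z : ℝ × ℝ => g z.2) 2 (scalarLaw P a)) :
    ∫ z, (z.1 - g z.2) ^ 2 ∂(scalarLaw P a) =
      meanSquareError P a + ∫ z, (estimate P a z.2 - g z.2) ^ 2 ∂(scalarLaw P a) := by
  have hx := memLp_input hP a
  have he := memLp_estimate hP a
  have hd := he.sub hg
  have h0 : ∫ z, (z.1 - estimate P a z.2) * (estimate P a z.2 - g z.2) ∂(scalarLaw P a) = 0 := by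
    have h := integral_estimate_mul hP (g := fun y => estimate P a y - g y) hd
    simp only [sub_mul (_ : ℝ) (estimate P a _)]
    have h1 : Integrable (fun z : ℝ × ℝ => z.1 * (estimate P a z.2 - g z.2)) (scalarLaw P a) :=
      hx.integrable_mul hd
    have h2 : Integrable (fun z : ℝ × ℝ => estimate P a z.2 * (estimate P a z.2 - g z.2))
      (scalarLaw P a) := he.integrable_mul hd
    rw [integral_sub h1 h2, h, sub_self]
  have h1 : Integrable (fun z : ℝ × ℝ => (z.1 - estimate P a z.2) ^ 2) (scalarLaw P a) :=
    (hx.sub he).integrable_sq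
  have h2 : Integrable (fun z : ℝ × ℝ => (estimate P a z.2 - g z.2) ^ 2) (scalarLaw P a) :=
    hd.integrable_sq
  have h3 : Integrable (fun z : ℝ × ℝ => 2 * ((z.1 - estimate P a z.2) *
      (estimate P a z.2 - g z.2))) (scalarLaw P a) := ((hx.sub he).integrable_mul hd).const_mul 2
  have e : ∀ z : ℝ × ℝ, (z.1 - g z.2) ^ 2 = (z.1 - estimate P a z.2) ^ 2 +
      (estimate P a z.2 - g z.2) ^ 2 + 2 * ((z.1 - estimate P a z.2) *
      (estimate P a z.2 - g z.2)) := fun z => by ring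
  simp only [e]
  rw [integral_add (f := fun z : ℝ × ℝ => (z.1 - estimate P a z.2) ^ 2 +
      (estimate P a z.2 - g z.2) ^ 2) (h1.add h2) h3, integral_add h1 h2, integral_const_mul, h0,
    meanSquareError]
  ring

theorem meanSquareError_nonneg (a : ℝ) : 0 ≤ meanSquareError P a :=
  integral_nonneg fun _ => sq_nonneg _

theorem one_eq_meanSquareError_add (hP : ∫ x, x ^ 2 ∂P = 1) (a : ℝ) :
    1 = meanSquareError P a + ∫ z, estimate P a z.2 ^ 2 ∂(scalarLaw P a) := by
  have h := integral_sq_sub_eq hP (a := a) (g := fun _ => 0) (by simp)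
  simpa only [sub_zero, integral_sq_input hP] using h

theorem meanSquareError_le_one (hP : ∫ x, x ^ 2 ∂P = 1) (a : ℝ) : meanSquareError P a ≤ 1 := by
  have h := one_eq_meanSquareError_add hP a
  have : 0 ≤ ∫ z, estimate P a z.2 ^ 2 ∂(scalarLaw P a) := integral_nonneg fun _ => sq_nonneg _
  linarith

theorem memLp_noise_prod : MemLp (fun ω : ℝ × ℝ => ω.2) 2 (P.prod (gaussianReal 0 1)) := by
  have h := memLp_two_noise
  rw [show gaussianReal 0 1 = (P.prod (gaussianReal 0 1)).map Prod.snd by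
    exact (Measure.map_snd_prod.trans (by simp)).symm] at h
  exact (memLp_map_measure_iff measurable_id.aestronglyMeasurable measurable_snd.aemeasurable).1 h

theorem memLp_input_prod (hP : ∫ x, x ^ 2 ∂P = 1) :
    MemLp (fun ω : ℝ × ℝ => ω.1) 2 (P.prod (gaussianReal 0 1)) :=
  (memLp_map_measure_iff (f := fun ω : ℝ × ℝ => (ω.1, (0 : ℝ) * ω.1 + ω.2))
    measurable_fst.aestronglyMeasurable (by fun_prop)).1 (memLp_input hP 0)

theorem integral_sq_noise_prod : ∫ ω : ℝ × ℝ, ω.2 ^ 2 ∂(P.prod (gaussianReal 0 1)) = 1 := by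
  rw [integral_fun_snd (fun w : ℝ => w ^ 2), integral_sq_noise]; simp

/-- The estimate `y / a` has mean square error `1 / a²`. -/
theorem meanSquareError_le_inv_sq (hP : ∫ x, x ^ 2 ∂P = 1) {a : ℝ} (ha : a ≠ 0) :
    meanSquareError P a ≤ 1 / a ^ 2 := by
  have hg : MemLp (fun z : ℝ × ℝ => z.2 / a) 2 (scalarLaw P a) := by
    refine (memLp_map_measure_iff (by fun_prop) (by fun_prop)).2 ?_
    have h : MemLp (fun ω : ℝ × ℝ => a⁻¹ * (a * ω.1 + ω.2)) 2 (P.prod (gaussianReal 0 1)) :=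
      (((memLp_input_prod hP).const_mul a).add memLp_noise_prod).const_mul a⁻¹
    convert h using 2 with ω
    simp [div_eq_inv_mul]
  have h := integral_sq_sub_eq hP (g := fun y => y / a) hg
  rw [integral_scalarLaw a (by fun_prop)] at h
  have e : ∀ ω : ℝ × ℝ, (ω.1 - (a * ω.1 + ω.2) / a) ^ 2 = 1 / a ^ 2 * ω.2 ^ 2 := fun ω => by
    field_simp; ring
  simp only [e] at h
  rw [integral_const_mul, integral_sq_noise_prod, mul_one] at h
  have : 0 ≤ ∫ z, (estimate P a z.2 - z.2 / a) ^ 2 ∂(scalarLaw P a) :=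
    integral_nonneg fun _ => sq_nonneg _
  linarith

/-- The estimate defined by Bayes' formula is the conditional expectation of the input. -/
theorem condExp_input_ae_eq (hP : ∫ x, x ^ 2 ∂P = 1) (a : ℝ) :
    (fun ω : ℝ × ℝ => estimate P a (a * ω.1 + ω.2)) =ᵐ[P.prod (gaussianReal 0 1)]
      (P.prod (gaussianReal 0 1))[fun ω : ℝ × ℝ => ω.1 |
        MeasurableSpace.comap (fun ω : ℝ × ℝ => a * ω.1 + ω.2) inferInstance] := by
  have hY : Measurable fun ω : ℝ × ℝ => a * ω.1 + ω.2 := by fun_prop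
  have hc := continuous_estimate (P := P) hP a
  have hei : Integrable (fun ω : ℝ × ℝ => estimate P a (a * ω.1 + ω.2))
      (P.prod (gaussianReal 0 1)) :=
    (integrable_scalarLaw_iff a (f := fun z => estimate P a z.2)
      (hc.measurable.comp measurable_snd)).1 ((memLp_estimate hP a).integrable (by norm_num))
  refine ae_eq_condExp_of_forall_setIntegral_eq hY.comap_le
    ((memLp_input_prod hP).integrable (by norm_num)) (fun s _ _ => hei.integrableOn) ?_ ?_
  · rintro _ ⟨B, hB, rfl⟩ -
    have hb : Measurable (B.indicator fun _ : ℝ => (1 : ℝ)) := measurable_one.indicator hB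
    have hg : MemLp (fun z : ℝ × ℝ => B.indicator (fun _ : ℝ => (1 : ℝ)) z.2) 2
        (scalarLaw P a) := by
      refine MemLp.of_bound (hb.comp measurable_snd).aestronglyMeasurable 1
        (Filter.Eventually.of_forall fun z => ?_)
      by_cases hz : z.2 ∈ B <;> simp [hz]
    have h := integral_estimate_mul hP hg
    rw [integral_scalarLaw a (f := fun z => estimate P a z.2 * B.indicator (fun _ => 1) z.2)
        ((hc.measurable.comp measurable_snd).mul (hb.comp measurable_snd)),
      integral_scalarLaw a (f := fun z => z.1 * B.indicator (fun _ => 1) z.2)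
        (measurable_fst.mul (hb.comp measurable_snd))] at h
    rw [← integral_indicator (hY hB), ← integral_indicator (hY hB)]
    convert h using 2 with ω <;> ext ω <;> by_cases hz : a * ω.1 + ω.2 ∈ B <;>
      simp [Set.indicator, hz]
  · exact (hc.measurable.comp (comap_measurable _)).aestronglyMeasurable

theorem mmse_eq_meanSquareError (hP : ∫ x, x ^ 2 ∂P = 1) (snr : ℝ) :
    mmse P snr = meanSquareError P √snr := by
  have hc := continuous_estimate (P := P) hP √snr
  rw [mmse, meanSquareError, integral_scalarLaw _ (by fun_prop)]
  refine integral_congr_ae ?_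
  filter_upwards [condExp_input_ae_eq hP √snr] with ω hω
  rw [← hω]

end

/-! ### Strict monotonicity of the error -/

section

variable {P : Measure ℝ} [IsProbabilityMeasure P]

/-- A channel of positive amplitude whose conditional mean estimate ignores the output has a
constant input: the estimates at two outputs placed symmetrically around `a c` differ, because the
likelihood ratio of these outputs is monotone in the input. -/
theorem eq_dirac_of_estimate_const (hP : ∫ x, x ^ 2 ∂P = 1) {a c : ℝ} (ha : 0 < a)
    (hc : ∀ y, estimate P a y = c) : P = Measure.dirac c := by
  have hi : ∀ y, Integrable (fun x => (x - c) * likelihood a x y) P := fun y =>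
    Integrable.mul_likelihood ((integrable_id_of_unit_power hP).sub (integrable_const c)) a y
  have h0 : ∀ y, ∫ x, (x - c) * likelihood a x y ∂P = 0 := fun y => by
    have h := hc y
    rw [estimate, posteriorMean, div_eq_iff (evidence_pos a y).ne', weighted, evidence,
      ← integral_const_mul] at h
    simp only [sub_mul]
    rw [integral_sub (Integrable.mul_likelihood (integrable_id_of_unit_power hP) a y)
      ((integrable_likelihood a y).const_mul c), h, sub_self]
  have hd : ∫ x, ((x - c) * likelihood a x (a * c + 1) -
      (x - c) * likelihood a x (a * c - 1)) ∂P = 0 := by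
    rw [integral_sub (hi _) (hi _), h0, h0, sub_self]
  have hlt : ∀ x, (c < x → likelihood a x (a * c - 1) < likelihood a x (a * c + 1)) ∧
      (x < c → likelihood a x (a * c + 1) < likelihood a x (a * c - 1)) := fun x => by
    constructor <;> intro hx <;> refine Real.exp_lt_exp.2 ?_ <;>
      nlinarith [mul_lt_mul_of_pos_left hx ha]
  have hn : ∀ x, 0 ≤ (x - c) * likelihood a x (a * c + 1) -
      (x - c) * likelihood a x (a * c - 1) := fun x => by
    rcases lt_trichotomy x c with h | h | h
    · nlinarith [(hlt x).2 h]
    · simp [h]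
    · nlinarith [(hlt x).1 h]
  rw [integral_eq_zero_iff_of_nonneg hn ((hi _).sub (hi _))] at hd
  have hae : (fun x : ℝ => x) =ᵐ[P] fun _ => c := by
    filter_upwards [hd] with x hx
    simp only [Pi.zero_apply] at hx
    rcases lt_trichotomy x c with h | h | h
    · nlinarith [(hlt x).2 h]
    · exact h
    · nlinarith [(hlt x).1 h]
  calc P = P.map fun x => x := Measure.map_id'.symm
    _ = P.map fun _ => c := Measure.map_congr hae
    _ = Measure.dirac c := by rw [Measure.map_const]; simp

theorem map_noise_rotation {α β : ℝ} (h : α ^ 2 + β ^ 2 = 1) :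
    ((gaussianReal 0 1).prod (gaussianReal 0 1)).map (fun q : ℝ × ℝ => α * q.1 + β * q.2) =
      gaussianReal 0 1 := by
  have e : (fun q : ℝ × ℝ => α * q.1 + β * q.2) =
      (fun q : ℝ × ℝ => q.1 + q.2) ∘ Prod.map (α * ·) (β * ·) := rfl
  rw [e, ← Measure.map_map (by fun_prop) (by fun_prop),
    ← Measure.map_prod_map _ _ (by fun_prop) (by fun_prop), gaussianReal_map_const_mul,
    gaussianReal_map_const_mul]
  refine (gaussianReal_conv_gaussianReal).trans ?_
  congr 1
  · simp
  · ext; simpa using h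

/-- Scaling the noise by `α` and adding independent noise of variance `β²`, where `α² + β² = 1`,
does not change the joint law of input and noise. -/
theorem measurePreserving_degrade {α β : ℝ} (h : α ^ 2 + β ^ 2 = 1) :
    MeasurePreserving (fun q : (ℝ × ℝ) × ℝ => (q.1.1, α * q.1.2 + β * q.2))
      ((P.prod (gaussianReal 0 1)).prod (gaussianReal 0 1)) (P.prod (gaussianReal 0 1)) := by
  have h1 : MeasurePreserving (fun q : ℝ × ℝ => α * q.1 + β * q.2)
      ((gaussianReal 0 1).prod (gaussianReal 0 1)) (gaussianReal 0 1) :=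
    ⟨by fun_prop, map_noise_rotation h⟩
  exact ((MeasurePreserving.id P).prod h1).comp
    (measurePreserving_prodAssoc P (gaussianReal 0 1) (gaussianReal 0 1))

theorem memLp_estimate_prod (hP : ∫ x, x ^ 2 ∂P = 1) (a : ℝ) :
    MemLp (fun ω : ℝ × ℝ => estimate P a (a * ω.1 + ω.2)) 2 (P.prod (gaussianReal 0 1)) :=
  (memLp_map_measure_iff (g := fun z : ℝ × ℝ => estimate P a z.2)
    (f := fun ω : ℝ × ℝ => (ω.1, a * ω.1 + ω.2))
    ((continuous_estimate hP a).comp continuous_snd).aestronglyMeasurable (by fun_prop)).1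
    (memLp_estimate hP a)

/-- The output `y` at amplitude `t`, turned into the output `α y + β v` at amplitude `α t` by
independent noise `v`: the estimate from the latter is square integrable for almost every `v`. -/
theorem ae_memLp_degraded (hP : ∫ x, x ^ 2 ∂P = 1) {α β : ℝ} (h : α ^ 2 + β ^ 2 = 1) (t : ℝ) :
    ∀ᵐ v ∂(gaussianReal 0 1),
      MemLp (fun z : ℝ × ℝ => estimate P (α * t) (α * z.2 + β * v)) 2 (scalarLaw P t) := by
  have hcs := continuous_estimate (P := P) hP (α * t)
  have hes : MemLp (fun ω : ℝ × ℝ => estimate P (α * t) (α * t * ω.1 + ω.2)) 2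
      (P.prod (gaussianReal 0 1)) := memLp_estimate_prod hP (α * t)
  filter_upwards [(hes.comp_measurePreserving
    (measurePreserving_degrade h)).integrable_sq.prod_left_ae] with v hv
  refine (memLp_map_measure_iff (by fun_prop) (by fun_prop)).2 ?_
  refine (memLp_two_iff_integrable_sq (by fun_prop)).2 ?_
  simpa only [Function.comp_def, mul_add, add_assoc, mul_assoc] using hv

/-- The error at the smaller amplitude `α t` exceeds the error at amplitude `t` by the mean square
difference of the two estimates. -/
theorem meanSquareError_mul_eq (hP : ∫ x, x ^ 2 ∂P = 1) {α β : ℝ} (h : α ^ 2 + β ^ 2 = 1) (t : ℝ) :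
    Integrable (fun v => ∫ z, (estimate P t z.2 - estimate P (α * t) (α * z.2 + β * v)) ^ 2
      ∂(scalarLaw P t)) (gaussianReal 0 1) ∧
    meanSquareError P (α * t) = meanSquareError P t +
      ∫ v, ∫ z, (estimate P t z.2 - estimate P (α * t) (α * z.2 + β * v)) ^ 2 ∂(scalarLaw P t)
        ∂(gaussianReal 0 1) := by
  have hT := measurePreserving_degrade (P := P) h
  have hcs := continuous_estimate (P := P) hP (α * t)
  have hes := memLp_estimate_prod (P := P) hP (α * t)
  have e : ∀ (ω : ℝ × ℝ) (v : ℝ), α * t * ω.1 + (α * ω.2 + β * v) =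
      α * (t * ω.1 + ω.2) + β * v := fun ω v => by ring
  have hd : Integrable (fun q : (ℝ × ℝ) × ℝ =>
      (q.1.1 - estimate P (α * t) (α * (t * q.1.1 + q.1.2) + β * q.2)) ^ 2)
      ((P.prod (gaussianReal 0 1)).prod (gaussianReal 0 1)) := by
    have := hT.integrable_comp_of_integrable ((memLp_input_prod hP).sub hes).integrable_sq
    simpa only [Function.comp_def, Pi.sub_apply, e] using this
  have hinner : ∀ᵐ v ∂(gaussianReal 0 1),
      ∫ ω : ℝ × ℝ, (ω.1 - estimate P (α * t) (α * (t * ω.1 + ω.2) + β * v)) ^ 2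
        ∂(P.prod (gaussianReal 0 1)) = meanSquareError P t +
      ∫ z, (estimate P t z.2 - estimate P (α * t) (α * z.2 + β * v)) ^ 2 ∂(scalarLaw P t) := by
    filter_upwards [ae_memLp_degraded hP h t] with v hg
    rw [← integral_sq_sub_eq hP (g := fun y => estimate P (α * t) (α * y + β * v)) hg,
      integral_scalarLaw t (by fun_prop)]
  have hi : Integrable (fun v => ∫ z, (estimate P t z.2 -
      estimate P (α * t) (α * z.2 + β * v)) ^ 2 ∂(scalarLaw P t)) (gaussianReal 0 1) := by
    refine (hd.integral_prod_right.sub (integrable_const (meanSquareError P t))).congr ?_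
    filter_upwards [hinner] with v hv
    exact sub_eq_of_eq_add' hv
  refine ⟨hi, ?_⟩
  calc meanSquareError P (α * t)
      = ∫ q : (ℝ × ℝ) × ℝ, (q.1.1 - estimate P (α * t) (α * (t * q.1.1 + q.1.2) + β * q.2)) ^ 2
          ∂((P.prod (gaussianReal 0 1)).prod (gaussianReal 0 1)) := by
        rw [meanSquareError, integral_scalarLaw _ (by fun_prop)]
        conv_lhs => rw [← hT.map_eq, integral_map hT.measurable.aemeasurable (by fun_prop)]
        simp only [e]
    _ = _ := by
        rw [integral_prod_symm _ hd, integral_congr_ae hinner, integral_add (integrable_const _) hi]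
        simp

theorem exists_degradation {s t : ℝ} (hs : 0 ≤ s) (hst : s < t) :
    ∃ α β : ℝ, α ^ 2 + β ^ 2 = 1 ∧ 0 < β ∧ s = α * t := by
  have ht : 0 < t := hs.trans_lt hst
  have h1 : (s / t) ^ 2 < 1 := by
    rw [div_pow, div_lt_one (by positivity)]; nlinarith
  refine ⟨s / t, √(1 - (s / t) ^ 2), ?_, Real.sqrt_pos.2 (by linarith), by field_simp⟩
  rw [Real.sq_sqrt (by linarith)]; ring

theorem meanSquareError_antitone (hP : ∫ x, x ^ 2 ∂P = 1) {s t : ℝ} (hs : 0 ≤ s) (hst : s ≤ t) :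
    meanSquareError P t ≤ meanSquareError P s := by
  rcases hst.eq_or_lt with rfl | hst
  · exact le_rfl
  obtain ⟨α, β, h, -, rfl⟩ := exists_degradation hs hst
  rw [(meanSquareError_mul_eq hP h t).2]
  exact le_add_of_nonneg_right (integral_nonneg fun _ => integral_nonneg fun _ => sq_nonneg _)

theorem eq_of_ae_noise {f g : ℝ → ℝ} (hf : Continuous f) (hg : Continuous g)
    (h : ∀ᵐ w ∂(gaussianReal 0 1), f w = g w) : f = g :=
  (Continuous.ae_eq_iff_eq volume hf hg).1
    (gaussianReal_absolutelyContinuous' 0 one_ne_zero |>.ae_le h)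

theorem meanSquareError_strictAnti_of_pos (hP : ∫ x, x ^ 2 ∂P = 1)
    (hd : ∀ c, P ≠ Measure.dirac c) {s t : ℝ} (hs : 0 < s) (hst : s < t) :
    meanSquareError P t < meanSquareError P s := by
  refine (meanSquareError_antitone hP hs.le hst.le).lt_of_ne fun heq => ?_
  obtain ⟨α, β, h, hβ, rfl⟩ := exists_degradation hs.le hst
  obtain ⟨hi, he⟩ := meanSquareError_mul_eq hP h t
  have hct := continuous_estimate (P := P) hP t
  have hcs := continuous_estimate (P := P) hP (α * t)
  have h0 : ∫ v, ∫ z, (estimate P t z.2 - estimate P (α * t) (α * z.2 + β * v)) ^ 2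
      ∂(scalarLaw P t) ∂(gaussianReal 0 1) = 0 := by linarith
  rw [integral_eq_zero_iff_of_nonneg (fun v => integral_nonneg fun z => sq_nonneg _) hi] at h0
  have hae : ∀ᵐ v ∂(gaussianReal 0 1), estimate P t 0 = estimate P (α * t) (β * v) := by
    -- integrability of the inner integrand excludes that its integral vanishes as a default value
    filter_upwards [h0, ae_memLp_degraded hP h t] with v hv hg
    have hsq : Integrable (fun z : ℝ × ℝ => (estimate P t z.2 -
        estimate P (α * t) (α * z.2 + β * v)) ^ 2) (scalarLaw P t) :=
      ((memLp_estimate hP t).sub hg).integrable_sq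
    have hz := (integral_eq_zero_iff_of_nonneg (fun z => sq_nonneg _) hsq).1 hv
    have hm := ae_of_ae_map (by fun_prop) hz
    obtain ⟨x, hx⟩ := (Measure.ae_ae_of_ae_prod hm).exists
    have hfun := eq_of_ae_noise (f := fun w => estimate P t (t * x + w))
      (g := fun w => estimate P (α * t) (α * (t * x + w) + β * v)) (by fun_prop) (by fun_prop)
      (hx.mono fun w hw => by
        simp only [Pi.zero_apply] at hw
        exact sub_eq_zero.1 (pow_eq_zero_iff two_ne_zero |>.1 hw))
    simpa using congrFun hfun (-(t * x))
  have hfun := eq_of_ae_noise continuous_const (by fun_prop) hae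
  refine hd _ (eq_dirac_of_estimate_const hP hs (c := estimate P t 0) fun y => ?_)
  have := congrFun hfun (y / β)
  simp only [mul_div_cancel₀ y hβ.ne'] at this
  exact this.symm

theorem meanSquareError_strictAnti (hP : ∫ x, x ^ 2 ∂P = 1)
    (hd : ∀ c, P ≠ Measure.dirac c) {s t : ℝ} (hs : 0 ≤ s) (hst : s < t) :
    meanSquareError P t < meanSquareError P s :=
  (meanSquareError_strictAnti_of_pos hP hd (s := (s + t) / 2) (by linarith) (by linarith)).trans_le
    (meanSquareError_antitone hP hs (by linarith))

end

/-! ### The derivative of the mutual information -/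

/-- The mutual information of the scalar channel as a function of its amplitude: minus one half
minus the expected logarithm of the marginal likelihood of the output. -/
noncomputable def scalarInfo (P : Measure ℝ) (a : ℝ) : ℝ :=
  -1 / 2 - ∫ ω : ℝ × ℝ, Real.log (evidence P a (a * ω.1 + ω.2)) ∂(P.prod (gaussianReal 0 1))

section

variable {P : Measure ℝ} [IsProbabilityMeasure P]

/-- Quadratic functions of input and noise, the dominating functions below. -/
theorem integrable_quadratic_bound (hP : ∫ x, x ^ 2 ∂P = 1) (α β γ : ℝ) :
    Integrable (fun ω : ℝ × ℝ => α * ω.1 ^ 2 + β * ω.2 ^ 2 + γ) (P.prod (gaussianReal 0 1)) :=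
  (((memLp_input_prod hP).integrable_sq.const_mul α).add
    (memLp_noise_prod.integrable_sq.const_mul β)).add (integrable_const γ)

theorem abs_log_evidence_le (hP : ∫ x, x ^ 2 ∂P = 1) (a x w : ℝ) :
    |Real.log (evidence P a (a * x + w))| ≤ 2 * a ^ 2 * x ^ 2 + 2 * w ^ 2 + a ^ 2 := by
  rw [abs_of_nonpos (log_evidence_nonpos _ _)]
  have := neg_log_evidence_le hP a (a * x + w)
  nlinarith [sq_nonneg (a * x - w)]

theorem continuous_log_evidence (a : ℝ) :
    Continuous fun ω : ℝ × ℝ => Real.log (evidence P a (a * ω.1 + ω.2)) :=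
  ((continuous_evidence a).comp (by fun_prop)).log fun ω => (evidence_pos a _).ne'

theorem integrable_log_evidence (hP : ∫ x, x ^ 2 ∂P = 1) (a : ℝ) :
    Integrable (fun ω : ℝ × ℝ => Real.log (evidence P a (a * ω.1 + ω.2)))
      (P.prod (gaussianReal 0 1)) :=
  (integrable_quadratic_bound hP (2 * a ^ 2) 2 (a ^ 2)).mono'
    (continuous_log_evidence a).aestronglyMeasurable
    (Filter.Eventually.of_forall fun ω => abs_log_evidence_le hP a ω.1 ω.2)

theorem continuous_evidence_amplitude (x w : ℝ) :
    Continuous fun a => evidence P a (a * x + w) := by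
  refine continuous_of_dominated (bound := fun _ => 1)
    (fun a => (integrable_likelihood a _).aestronglyMeasurable)
    (fun a => Filter.Eventually.of_forall fun x' => ?_) (integrable_const 1)
    (Filter.Eventually.of_forall fun x' => ?_)
  · rw [Real.norm_eq_abs, abs_of_pos (likelihood_pos _ _ _)]; exact likelihood_le_one _ _ _
  · unfold likelihood; fun_prop

theorem continuous_scalarInfo (hP : ∫ x, x ^ 2 ∂P = 1) : Continuous (scalarInfo P) := by
  refine continuous_const.sub (continuous_iff_continuousAt.2 fun a₀ => ?_)
  refine continuousAt_of_dominated
    (bound := fun ω : ℝ × ℝ => 2 * (|a₀| + 1) ^ 2 * ω.1 ^ 2 + 2 * ω.2 ^ 2 + (|a₀| + 1) ^ 2)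
    (Filter.Eventually.of_forall fun a => (continuous_log_evidence a).aestronglyMeasurable) ?_
    (integrable_quadratic_bound hP _ _ _)
    (Filter.Eventually.of_forall fun ω => ((continuous_evidence_amplitude ω.1 ω.2).log
      fun a => (evidence_pos a _).ne').continuousAt)
  filter_upwards [Metric.ball_mem_nhds a₀ one_pos] with a ha
  refine Filter.Eventually.of_forall fun ω => (abs_log_evidence_le hP a ω.1 ω.2).trans ?_
  have h1 : a ^ 2 ≤ (|a₀| + 1) ^ 2 := by
    rw [Metric.mem_ball, Real.dist_eq] at ha
    have := abs_sub_abs_le_abs_sub a a₀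
    rw [← sq_abs a]
    exact pow_le_pow_left₀ (abs_nonneg _) (by linarith) 2
  nlinarith [sq_nonneg ω.1]

/-- The derivative in `a` of the logarithm of `evidence P a (a x + w)`, in terms of posterior
means. -/
noncomputable def logEvidenceDeriv (P : Measure ℝ) (a : ℝ) (z : ℝ × ℝ) : ℝ :=
  -(z.2 * z.1 - z.2 * estimate P a z.2 - a * (z.1 * estimate P a z.2) +
    a * posteriorMean P a (fun x => x ^ 2) z.2)

theorem hasDerivAt_log_evidence (hP : ∫ x, x ^ 2 ∂P = 1) (x w a : ℝ) :
    HasDerivAt (fun a => Real.log (evidence P a (a * x + w)))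
      (logEvidenceDeriv P a (x, a * x + w)) a := by
  have h2 := integrable_sq_of_unit_power hP
  have h1 := integrable_id_of_unit_power hP
  have hd : HasDerivAt (fun a => evidence P a (a * x + w))
      (∫ x', -((a * x + w - a * x') * (x - x')) * likelihood a x' (a * x + w) ∂P) a := by
    refine (hasDerivAt_integral_of_dominated_loc_of_deriv_le
      (bound := fun x' => (2 * (|a| + 1) + 1) * (x ^ 2 + x' ^ 2) + w ^ 2)
      (s := Metric.ball a 1)
      (F' := fun a x' => -((a * x + w - a * x') * (x - x')) * likelihood a x' (a * x + w))
      (Metric.ball_mem_nhds a one_pos)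
      (Filter.Eventually.of_forall fun b => (integrable_likelihood b _).aestronglyMeasurable)
      (integrable_likelihood a _) ?_ ?_ ?_ ?_).2
    · refine Continuous.aestronglyMeasurable ?_
      unfold likelihood; fun_prop
    · refine Filter.Eventually.of_forall fun x' b hb => ?_
      have hb1 : |b| ≤ |a| + 1 := by
        rw [Metric.mem_ball, Real.dist_eq] at hb
        have := abs_sub_abs_le_abs_sub b a
        linarith
      rw [norm_mul, Real.norm_eq_abs, Real.norm_eq_abs, abs_of_pos (likelihood_pos _ _ _)]
      refine (mul_le_of_le_one_right (abs_nonneg _) (likelihood_le_one _ _ _)).trans ?_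
      have e : -((b * x + w - b * x') * (x - x')) = -(b * (x - x') ^ 2) - w * (x - x') := by ring
      rw [e]
      refine (abs_sub _ _).trans ?_
      rw [abs_neg, abs_mul, abs_mul, abs_of_nonneg (sq_nonneg (x - x'))]
      have h3 : (x - x') ^ 2 ≤ 2 * (x ^ 2 + x' ^ 2) := by nlinarith [sq_nonneg (x + x')]
      have h4 : |w| * |x - x'| ≤ w ^ 2 + (x ^ 2 + x' ^ 2) := by
        rw [← sq_abs w]
        nlinarith [sq_nonneg (|w| - |x - x'|), sq_abs (x - x'), sq_nonneg w, sq_abs w]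
      have h5 : |b| * (x - x') ^ 2 ≤ (|a| + 1) * (2 * (x ^ 2 + x' ^ 2)) :=
        mul_le_mul hb1 h3 (sq_nonneg _) (by positivity)
      linarith
    · exact (((integrable_const _).add h2).const_mul _).add (integrable_const _)
    · refine Filter.Eventually.of_forall fun x' b _ => ?_
      have hi : HasDerivAt (fun b => -(b * x + w - b * x') ^ 2 / 2)
          (-((b * x + w - b * x') * (x - x'))) b := by
        have hl : HasDerivAt (fun b => b * x + w - b * x') (x - x') b := by
          simpa using! (((hasDerivAt_id b).mul_const x).add_const w).sub
            ((hasDerivAt_id b).mul_const x')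
        refine ((hl.pow 2).neg.div_const 2).congr_deriv ?_
        ring
      have := hi.exp
      rw [mul_comm] at this
      exact this
  have hlog := hd.log (evidence_pos a _).ne'
  convert hlog using 1
  have hq := posteriorMean_quadratic hP a (-a) (a * x + (a * x + w)) (-((a * x + w) * x))
    (a * x + w)
  have e : (fun x' => -((a * x + w - a * x') * (x - x'))) =
      fun x' => -a * x' ^ 2 + (a * x + (a * x + w)) * x' + -((a * x + w) * x) := by
    ext x'; ring
  change _ = posteriorMean P a (fun x' => -((a * x + w - a * x') * (x - x'))) (a * x + w)
  rw [e, hq]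
  simp only [logEvidenceDeriv, estimate]
  ring

theorem abs_logEvidenceDeriv_le (hP : ∫ x, x ^ 2 ∂P = 1) {a₀ a : ℝ} (ha₀ : 0 < a₀)
    (h1 : a₀ / 2 < a) (h2 : a < 2 * a₀) (x w : ℝ) :
    |logEvidenceDeriv P a (x, a * x + w)| ≤
      (8 * a₀ ^ 2 + a₀ + 1 + (3 * a₀ + 1) * 12) * x ^ 2 +
      (2 + (3 * a₀ + 1) * (48 / a₀ ^ 2)) * w ^ 2 + (3 * a₀ + 1) * 4 := by
  have ha : 0 < a := by linarith
  set y := a * x + w with hy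
  set M := posteriorMean P a (fun x => x ^ 2) y with hM
  have he := sq_posteriorMean_le hP a y
  have hMb := sq_mul_posteriorMean_sq_le hP a y
  simp only [logEvidenceDeriv]
  rw [← hM] at he hMb ⊢
  change estimate P a y ^ 2 ≤ M at he
  set e := estimate P a y
  have hy2 : y ^ 2 ≤ 2 * (a ^ 2 * x ^ 2) + 2 * w ^ 2 := by
    rw [hy]; nlinarith [sq_nonneg (a * x - w)]
  have hM0 : 0 ≤ M := (sq_nonneg e).trans he
  have hM' : M ≤ 12 * x ^ 2 + 48 / a₀ ^ 2 * w ^ 2 + 4 := by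
    have hw : w ^ 2 / a ^ 2 ≤ 4 / a₀ ^ 2 * w ^ 2 := by
      rw [div_mul_eq_mul_div, div_le_div_iff₀ (by positivity) (by positivity)]
      have : a₀ ^ 2 ≤ 4 * a ^ 2 := by nlinarith
      nlinarith [mul_le_mul_of_nonneg_left this (sq_nonneg w)]
    have h : M ≤ 12 * x ^ 2 + 12 * (w ^ 2 / a ^ 2) + 4 := by
      have : a ^ 2 * M ≤ a ^ 2 * (12 * x ^ 2 + 12 * (w ^ 2 / a ^ 2) + 4) := by
        have : a ^ 2 * (w ^ 2 / a ^ 2) = w ^ 2 := by field_simp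
        nlinarith
      exact le_of_mul_le_mul_left this (by positivity)
    have e4 : 48 / a₀ ^ 2 * w ^ 2 = 12 * (4 / a₀ ^ 2 * w ^ 2) := by ring
    linarith
  have ha2 : a ^ 2 * x ^ 2 ≤ 4 * a₀ ^ 2 * x ^ 2 :=
    mul_le_mul_of_nonneg_right (by nlinarith) (sq_nonneg x)
  have hax : a * x ^ 2 ≤ 2 * a₀ * x ^ 2 := mul_le_mul_of_nonneg_right h2.le (sq_nonneg x)
  have haM : a * M ≤ 2 * a₀ * M := mul_le_mul_of_nonneg_right h2.le hM0
  have hxe : |a * (x * e)| ≤ a * ((x ^ 2 + M) / 2) := by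
    rw [abs_mul, abs_of_pos ha]
    refine mul_le_mul_of_nonneg_left (abs_le.2 ⟨?_, ?_⟩) ha.le
    · nlinarith [sq_nonneg (x + e)]
    · nlinarith [sq_nonneg (x - e)]
  have hxe' := abs_le.1 hxe
  have key : |-(y * x - y * e - a * (x * e) + a * M)| ≤
      y ^ 2 + x ^ 2 / 2 + M / 2 + a * x ^ 2 / 2 + 3 * (a * M) / 2 := by
    refine abs_le.2 ⟨?_, ?_⟩
    · nlinarith [sq_nonneg (y - x), sq_nonneg (y + e), hxe'.1, hxe'.2]
    · nlinarith [sq_nonneg (y + x), sq_nonneg (y - e), hxe'.1, hxe'.2, mul_nonneg ha.le hM0]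
  refine key.trans ?_
  have hMfin : (3 * a₀ + 1) * M ≤ (3 * a₀ + 1) * (12 * x ^ 2 + 48 / a₀ ^ 2 * w ^ 2 + 4) :=
    mul_le_mul_of_nonneg_left hM' (by positivity)
  nlinarith [sq_nonneg x, sq_nonneg w]

theorem continuous_logEvidenceDeriv (hP : ∫ x, x ^ 2 ∂P = 1) (a : ℝ) :
    Continuous (logEvidenceDeriv P a) := by
  have h1 := continuous_estimate (P := P) hP a
  have h2 := continuous_posteriorMean (integrable_sq_of_unit_power hP) a
  unfold logEvidenceDeriv
  fun_prop

theorem memLp_output (hP : ∫ x, x ^ 2 ∂P = 1) (a : ℝ) :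
    MemLp (fun z : ℝ × ℝ => z.2) 2 (scalarLaw P a) :=
  (memLp_map_measure_iff (by fun_prop) (by fun_prop)).2
    (((memLp_input_prod hP).const_mul a).add memLp_noise_prod)

theorem integral_logEvidenceDeriv (hP : ∫ x, x ^ 2 ∂P = 1) (a : ℝ) :
    ∫ z, logEvidenceDeriv P a z ∂(scalarLaw P a) = -(a * meanSquareError P a) := by
  have hx := memLp_input hP a
  have hy := memLp_output hP a
  have he := memLp_estimate hP a
  have hm := integrable_posteriorMean_sq hP a
  have i1 : Integrable (fun z : ℝ × ℝ => z.2 * z.1) (scalarLaw P a) := hy.integrable_mul hx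
  have i2 : Integrable (fun z : ℝ × ℝ => z.2 * estimate P a z.2) (scalarLaw P a) :=
    hy.integrable_mul he
  have i3 : Integrable (fun z : ℝ × ℝ => a * (z.1 * estimate P a z.2)) (scalarLaw P a) :=
    (hx.integrable_mul he).const_mul a
  have h1 : ∫ z, z.2 * estimate P a z.2 ∂(scalarLaw P a) = ∫ z, z.2 * z.1 ∂(scalarLaw P a) := by
    have := integral_estimate_mul hP (g := fun y => y) hy
    simpa only [mul_comm] using this
  have h2 : ∫ z, z.1 * estimate P a z.2 ∂(scalarLaw P a) =
      ∫ z, estimate P a z.2 ^ 2 ∂(scalarLaw P a) := by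
    rw [← integral_estimate_mul hP (g := estimate P a) he]
    simp only [sq]
  have h3 := one_eq_meanSquareError_add hP a
  simp only [logEvidenceDeriv]
  rw [integral_neg, integral_add (f := fun z : ℝ × ℝ => z.2 * z.1 - z.2 * estimate P a z.2 -
      a * (z.1 * estimate P a z.2)) ((i1.sub i2).sub i3) (hm.1.const_mul a),
    integral_sub (f := fun z : ℝ × ℝ => z.2 * z.1 - z.2 * estimate P a z.2) (i1.sub i2) i3,
    integral_sub i1 i2, integral_const_mul, integral_const_mul, hm.2, h1, h2]
  linear_combination (-a) * h3

/-- The I-MMSE relation, in terms of the amplitude. -/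
theorem hasDerivAt_scalarInfo (hP : ∫ x, x ^ 2 ∂P = 1) {a₀ : ℝ} (ha₀ : 0 < a₀) :
    HasDerivAt (scalarInfo P) (a₀ * meanSquareError P a₀) a₀ := by
  have h := (hasDerivAt_integral_of_dominated_loc_of_deriv_le
    (μ := P.prod (gaussianReal 0 1)) (s := Set.Ioo (a₀ / 2) (2 * a₀))
    (F := fun a ω => Real.log (evidence P a (a * ω.1 + ω.2)))
    (F' := fun a ω => logEvidenceDeriv P a (ω.1, a * ω.1 + ω.2))
    (Ioo_mem_nhds (by linarith) (by linarith))
    (Filter.Eventually.of_forall fun a => (continuous_log_evidence a).aestronglyMeasurable)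
    (integrable_log_evidence hP a₀)
    ((continuous_logEvidenceDeriv hP a₀).comp (by fun_prop)).aestronglyMeasurable
    (Filter.Eventually.of_forall fun ω a ha =>
      abs_logEvidenceDeriv_le hP ha₀ ha.1 ha.2 ω.1 ω.2)
    (integrable_quadratic_bound hP _ _ _)
    (Filter.Eventually.of_forall fun ω a _ => hasDerivAt_log_evidence hP ω.1 ω.2 a)).2
  rw [← integral_scalarLaw a₀ (continuous_logEvidenceDeriv hP a₀).measurable,
    integral_logEvidenceDeriv hP] at h
  simpa [scalarInfo] using! h.const_sub (-1 / 2)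

end

/-! ### Mutual information of parallel Gaussian channels -/

/-- The divergence as the expectation of a logarithmic density, which is nonnegative by Gibbs'
inequality. -/
theorem klDiv_withDensity_ofReal {α : Type*} [MeasurableSpace α] {ρ μ : Measure α}
    [IsProbabilityMeasure ρ] [IsProbabilityMeasure μ] {g : α → ℝ} (hg : Measurable g)
    (hpos : ∀ z, 0 < g z) (h : ρ = μ.withDensity fun z => ENNReal.ofReal (g z))
    (hi : Integrable (fun z => Real.log (g z)) ρ) :
    InformationTheory.klDiv ρ μ = ENNReal.ofReal (∫ z, Real.log (g z) ∂ρ) ∧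
      0 ≤ ∫ z, Real.log (g z) ∂ρ := by
  have hac : ρ ≪ μ := h ▸ withDensity_absolutelyContinuous _ _
  have hl : llr ρ μ =ᵐ[ρ] fun z => Real.log (g z) := by
    have hr := Measure.rnDeriv_withDensity μ hg.ennreal_ofReal
    rw [← h] at hr
    filter_upwards [hac.ae_le hr] with z hz
    rw [llr, hz, ENNReal.toReal_ofReal (hpos z).le]
  have hli : Integrable (llr ρ μ) ρ := hi.congr hl.symm
  have h0 := InformationTheory.integral_llr_add_sub_measure_univ_nonneg hac hli
  rw [InformationTheory.klDiv_of_ac_of_integrable hac hli, integral_congr_ae hl]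
  rw [integral_congr_ae hl] at h0
  simpa using h0

theorem klDiv_map_equiv {α β : Type*} [MeasurableSpace α] [MeasurableSpace β] (e : α ≃ᵐ β)
    (μ ν : Measure α) [IsFiniteMeasure μ] [IsFiniteMeasure ν] :
    InformationTheory.klDiv (μ.map e) (ν.map e) = InformationTheory.klDiv μ ν := by
  refine le_antisymm (InformationTheory.klDiv_map_le μ ν e.measurable) ?_
  have h := InformationTheory.klDiv_map_le (μ.map e) (ν.map e) e.symm.measurable
  simpa using h

/-- A product of measures with densities has the product density. -/
theorem pi_withDensity {ι : Type*} [Fintype ι] {α : ι → Type*} [∀ i, MeasurableSpace (α i)]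
    (μ : ∀ i, Measure (α i)) [∀ i, IsProbabilityMeasure (μ i)] {f : ∀ i, α i → ENNReal}
    (hf : ∀ i, Measurable (f i)) [∀ i, SigmaFinite ((μ i).withDensity (f i))] :
    Measure.pi (fun i => (μ i).withDensity (f i)) =
      (Measure.pi μ).withDensity fun z => ∏ i, f i (z i) := by
  refine Measure.pi_eq fun s hs => ?_
  rw [withDensity_apply _ (MeasurableSet.univ_pi hs), ← lintegral_indicator
    (MeasurableSet.univ_pi hs)]
  have e : ((Set.univ.pi s).indicator fun z : (∀ i, α i) => ∏ i, f i (z i)) =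
      fun z => ∏ i, (s i).indicator (f i) (z i) := by
    ext z
    by_cases hz : z ∈ Set.univ.pi s
    · rw [Set.indicator_of_mem hz]
      exact Finset.prod_congr rfl fun i _ => (Set.indicator_of_mem (hz i (Set.mem_univ i)) _).symm
    · rw [Set.indicator_of_notMem hz]
      obtain ⟨i, hi⟩ : ∃ i, z i ∉ s i := by simpa [Set.mem_pi] using hz
      exact (Finset.prod_eq_zero (Finset.mem_univ i) (Set.indicator_of_notMem hi _)).symm
  have hm : ∀ i, Measurable ((s i).indicator (f i)) := fun i => (hf i).indicator (hs i)
  rw [e, lintegral_prod_eq_prod_lintegral_of_indepFun Finset.univ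
    (fun i (z : ∀ i, α i) => (s i).indicator (f i) (z i))
    (iIndepFun_pi (X := fun i => (s i).indicator (f i)) fun i => (hm i).aemeasurable)
    fun i => (hm i).comp (measurable_pi_apply i)]
  refine Finset.prod_congr rfl fun i _ => ?_
  rw [withDensity_apply _ (hs i), ← lintegral_indicator (hs i),
    ← (measurePreserving_eval μ i).map_eq, lintegral_map (hm i) (measurable_pi_apply i)]

section

variable {P : Measure ℝ} [IsProbabilityMeasure P]

theorem log_likelihoodRatio (a x w : ℝ) : Real.log (likelihoodRatio P a (x, a * x + w)) =
    -(1 / 2) * w ^ 2 - Real.log (evidence P a (a * x + w)) := by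
  rw [likelihoodRatio, Real.log_div (likelihood_pos _ _ _).ne' (evidence_pos _ _).ne', likelihood,
    Real.log_exp]
  ring

theorem integrable_log_likelihoodRatio (hP : ∫ x, x ^ 2 ∂P = 1) (a : ℝ) :
    Integrable (fun z => Real.log (likelihoodRatio P a z)) (scalarLaw P a) := by
  rw [integrable_scalarLaw_iff a (continuous_likelihoodRatio a).measurable.log]
  simp only [log_likelihoodRatio]
  exact (memLp_noise_prod.integrable_sq.const_mul _).sub (integrable_log_evidence hP a)

/-- The divergence of the joint law from the product of its marginals, in closed form: the squared
noise contributes the term `-1 / 2`. -/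
theorem integral_log_likelihoodRatio (hP : ∫ x, x ^ 2 ∂P = 1) (a : ℝ) :
    ∫ z, Real.log (likelihoodRatio P a z) ∂(scalarLaw P a) = scalarInfo P a := by
  rw [integral_scalarLaw a (continuous_likelihoodRatio a).measurable.log]
  simp only [log_likelihoodRatio]
  rw [integral_sub (memLp_noise_prod.integrable_sq.const_mul _) (integrable_log_evidence hP a),
    integral_const_mul, integral_sq_noise_prod, scalarInfo]
  ring

theorem scalarInfo_nonneg (hP : ∫ x, x ^ 2 ∂P = 1) (a : ℝ) : 0 ≤ scalarInfo P a := by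
  rw [← integral_log_likelihoodRatio hP a]
  exact (klDiv_withDensity_ofReal (continuous_likelihoodRatio a).measurable
    (likelihoodRatio_pos a) (scalarLaw_eq_withDensity a)
    (integrable_log_likelihoodRatio hP a)).2

end

section

variable {K : ℕ} {P : Fin K → Measure ℝ} [∀ k, IsProbabilityMeasure (P k)]

theorem gaussianChannelLaw_eq_map_pi (a : Fin K → ℝ) : gaussianChannelLaw P a =
    (Measure.pi fun k => scalarLaw (P k) (a k)).map
      (MeasurableEquiv.arrowProdEquivProdArrow ℝ ℝ (Fin K)) := by
  have h := (measurePreserving_arrowProdEquivProdArrow ℝ ℝ (Fin K) P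
    fun _ => gaussianReal 0 1).map_eq
  rw [gaussianChannelLaw, ← h, Measure.map_map (by fun_prop) (MeasurableEquiv.measurable _)]
  simp only [scalarLaw]
  rw [← Measure.pi_map_pi (fun k => by fun_prop), Measure.map_map (MeasurableEquiv.measurable _)
    (by fun_prop)]
  rfl

theorem fst_gaussianChannelLaw (a : Fin K → ℝ) : (gaussianChannelLaw P a).fst = Measure.pi P := by
  rw [gaussianChannelLaw_eq_map_pi, Measure.fst, Measure.map_map measurable_fst
    (MeasurableEquiv.measurable _)]
  have h := Measure.pi_map_pi (μ := fun k => scalarLaw (P k) (a k)) (f := fun _ => Prod.fst)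
    fun k => measurable_fst.aemeasurable
  refine Eq.trans (Eq.trans ?_ h) ?_
  · rfl
  · exact congrArg Measure.pi (funext fun k => fst_scalarLaw (a k))

theorem snd_gaussianChannelLaw (a : Fin K → ℝ) : (gaussianChannelLaw P a).snd =
    Measure.pi fun k => (scalarLaw (P k) (a k)).snd := by
  rw [gaussianChannelLaw_eq_map_pi, Measure.snd, Measure.map_map measurable_snd
    (MeasurableEquiv.measurable _)]
  exact Measure.pi_map_pi (μ := fun k => scalarLaw (P k) (a k)) (f := fun _ => Prod.snd)
    fun k => measurable_snd.aemeasurable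

/-- Parallel channels with independent inputs and noise: the informations add up. -/
theorem mutualInformation_gaussianChannelLaw (hP : ∀ k, ∫ x, x ^ 2 ∂(P k) = 1) (a : Fin K → ℝ) :
    mutualInformation (gaussianChannelLaw P a) =
      ENNReal.ofReal (∑ k, scalarInfo (P k) (a k)) := by
  have hsnd : ∀ k, IsProbabilityMeasure (scalarLaw (P k) (a k)).snd := fun k => inferInstance
  rw [mutualInformation, fst_gaussianChannelLaw, snd_gaussianChannelLaw,
    gaussianChannelLaw_eq_map_pi,
    ← (measurePreserving_arrowProdEquivProdArrow ℝ ℝ (Fin K) P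
      fun k => (scalarLaw (P k) (a k)).snd).map_eq, klDiv_map_equiv]
  have hm : ∀ k, Measurable (likelihoodRatio (P k) (a k)) :=
    fun k => (continuous_likelihoodRatio (a k)).measurable
  have hpos : ∀ z : Fin K → ℝ × ℝ, 0 < ∏ k, likelihoodRatio (P k) (a k) (z k) :=
    fun z => Finset.prod_pos fun k _ => likelihoodRatio_pos (a k) (z k)
  have hden : (Measure.pi fun k => scalarLaw (P k) (a k)) =
      (Measure.pi fun k => (P k).prod (scalarLaw (P k) (a k)).snd).withDensity
        fun z => ENNReal.ofReal (∏ k, likelihoodRatio (P k) (a k) (z k)) := by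
    have hsf : ∀ k, SigmaFinite (((P k).prod (scalarLaw (P k) (a k)).snd).withDensity
        fun z => ENNReal.ofReal (likelihoodRatio (P k) (a k) z)) := fun k => by
      rw [← scalarLaw_eq_withDensity]; infer_instance
    have h := pi_withDensity (fun k => (P k).prod (scalarLaw (P k) (a k)).snd)
      (f := fun k z => ENNReal.ofReal (likelihoodRatio (P k) (a k) z))
      fun k => (hm k).ennreal_ofReal
    simp only [← scalarLaw_eq_withDensity] at h
    rw [h]
    congr 1; ext z
    rw [ENNReal.ofReal_prod_of_nonneg fun k _ => (likelihoodRatio_pos (a k) (z k)).le]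
  have hlog : ∀ z : Fin K → ℝ × ℝ, Real.log (∏ k, likelihoodRatio (P k) (a k) (z k)) =
      ∑ k, Real.log (likelihoodRatio (P k) (a k) (z k)) :=
    fun z => Real.log_prod fun k _ => (likelihoodRatio_pos (a k) (z k)).ne'
  have hik : ∀ k, Integrable (fun z : Fin K → ℝ × ℝ =>
      Real.log (likelihoodRatio (P k) (a k) (z k))) (Measure.pi fun k => scalarLaw (P k) (a k)) :=
    fun k => (measurePreserving_eval (fun k => scalarLaw (P k) (a k))
      k).integrable_comp_of_integrable
      (integrable_log_likelihoodRatio (hP k) (a k))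
  have hi : Integrable (fun z : Fin K → ℝ × ℝ =>
      Real.log (∏ k, likelihoodRatio (P k) (a k) (z k)))
      (Measure.pi fun k => scalarLaw (P k) (a k)) := by
    simp only [hlog]
    exact integrable_finsetSum _ fun k _ => hik k
  rw [(klDiv_withDensity_ofReal (by fun_prop) hpos hden hi).1]
  simp only [hlog]
  rw [integral_finsetSum _ fun k _ => hik k]
  congr 1
  refine Finset.sum_congr rfl fun k _ => ?_
  rw [← integral_log_likelihoodRatio (hP k) (a k)]
  exact integral_comp_eval (μ := fun k => scalarLaw (P k) (a k))
    (hm k).log.aestronglyMeasurable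

end

/-! ### The inverse MMSE function and the mercury power -/

section

variable {P : Measure ℝ} [IsProbabilityMeasure P]

theorem mmse_nonneg (hP : ∫ x, x ^ 2 ∂P = 1) (γ : ℝ) : 0 ≤ mmse P γ := by
  rw [mmse_eq_meanSquareError hP]; exact meanSquareError_nonneg _

theorem mmse_le_one (hP : ∫ x, x ^ 2 ∂P = 1) (γ : ℝ) : mmse P γ ≤ 1 := by
  rw [mmse_eq_meanSquareError hP]; exact meanSquareError_le_one hP _

theorem mmse_le_inv (hP : ∫ x, x ^ 2 ∂P = 1) {γ : ℝ} (hγ : 0 < γ) : mmse P γ ≤ 1 / γ := by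
  rw [mmse_eq_meanSquareError hP]
  have h := meanSquareError_le_inv_sq hP (Real.sqrt_pos.2 hγ).ne'
  rwa [Real.sq_sqrt hγ.le] at h

theorem mmse_strictAntiOn (hP : ∫ x, x ^ 2 ∂P = 1) (hd : ∀ c, P ≠ Measure.dirac c) :
    StrictAntiOn (mmse P) (Set.Ici 0) := fun s hs t _ hst => by
  rw [mmse_eq_meanSquareError hP, mmse_eq_meanSquareError hP]
  exact meanSquareError_strictAnti hP hd (Real.sqrt_nonneg s) (Real.sqrt_lt_sqrt hs hst)

theorem mmse_pos (hP : ∫ x, x ^ 2 ∂P = 1) (hd : ∀ c, P ≠ Measure.dirac c) {γ : ℝ} (hγ : 0 ≤ γ) :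
    0 < mmse P γ :=
  (mmse_nonneg hP (γ + 1)).trans_lt
    (mmse_strictAntiOn hP hd hγ (Set.mem_Ici.2 (by linarith)) (by linarith))

theorem mmseInv_nonneg (ψ : ℝ) : 0 ≤ mmseInv P ψ := Real.sInf_nonneg fun _ h => h.1

theorem mmseInv_le {γ ψ : ℝ} (hγ : 0 ≤ γ) (h : mmse P γ ≤ ψ) : mmseInv P ψ ≤ γ :=
  csInf_le ⟨0, fun _ h => h.1⟩ ⟨hγ, h⟩

theorem nonempty_mmse_le (hP : ∫ x, x ^ 2 ∂P = 1) {ψ : ℝ} (hψ : 0 < ψ) :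
    {snr : ℝ | 0 ≤ snr ∧ mmse P snr ≤ ψ}.Nonempty :=
  ⟨1 / ψ, by positivity, by simpa using mmse_le_inv hP (one_div_pos.2 hψ)⟩

theorem le_mmseInv (hP : ∫ x, x ^ 2 ∂P = 1) (hd : ∀ c, P ≠ Measure.dirac c) {γ ψ : ℝ}
    (hγ : 0 ≤ γ) (hψ : 0 < ψ) (h : ψ < mmse P γ) : γ ≤ mmseInv P ψ :=
  le_csInf (nonempty_mmse_le hP hψ) fun _ hs =>
    ((mmse_strictAntiOn hP hd).lt_iff_gt hs.1 hγ |>.1 (hs.2.trans_lt h)).le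

theorem lt_mmse_of_lt_mmseInv {γ ψ : ℝ} (hγ : 0 ≤ γ) (h : γ < mmseInv P ψ) : ψ < mmse P γ :=
  lt_of_not_ge fun hle => (mmseInv_le hγ hle).not_gt h

theorem mmse_lt_of_mmseInv_lt (hP : ∫ x, x ^ 2 ∂P = 1) (hd : ∀ c, P ≠ Measure.dirac c) {γ ψ : ℝ}
    (hψ : 0 < ψ) (h : mmseInv P ψ < γ) : mmse P γ < ψ := by
  obtain ⟨s, hs, hsγ⟩ := exists_lt_of_csInf_lt (nonempty_mmse_le hP hψ) h
  exact (mmse_strictAntiOn hP hd hs.1 (Set.mem_Ici.2 (hs.1.trans hsγ.le)) hsγ).trans_le hs.2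

theorem mmseInv_antitoneOn (hP : ∫ x, x ^ 2 ∂P = 1) : AntitoneOn (mmseInv P) (Set.Ioi 0) :=
  fun _ hψ _ _ hle => csInf_le_csInf ⟨0, fun _ h => h.1⟩ (nonempty_mmse_le hP hψ)
    fun _ h => ⟨h.1, h.2.trans hle⟩

theorem mmseInv_eq_zero (hP : ∫ x, x ^ 2 ∂P = 1) {ψ : ℝ} (h : 1 ≤ ψ) : mmseInv P ψ = 0 :=
  le_antisymm (mmseInv_le le_rfl ((mmse_le_one hP 0).trans h)) (mmseInv_nonneg ψ)

/-- The generalized inverse of a strictly monotone function is continuous, whether or not the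
function itself is. -/
theorem continuousAt_mmseInv (hP : ∫ x, x ^ 2 ∂P = 1) (hd : ∀ c, P ≠ Measure.dirac c) {ψ : ℝ}
    (hψ : 0 < ψ) : ContinuousAt (mmseInv P) ψ := by
  refine tendsto_order.2 ⟨fun b hb => ?_, fun b hb => ?_⟩
  · rcases lt_or_ge b 0 with h0 | h0
    · exact Filter.Eventually.of_forall fun ψ' => h0.trans_le (mmseInv_nonneg ψ')
    obtain ⟨γ, h1, h2⟩ := exists_between hb
    filter_upwards [eventually_gt_nhds hψ,
      eventually_lt_nhds (lt_mmse_of_lt_mmseInv (h0.trans h1.le) h2)] with ψ' hp hl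
    exact h1.trans_le (le_mmseInv hP hd (h0.trans h1.le) hp hl)
  · obtain ⟨γ, h1, h2⟩ := exists_between hb
    filter_upwards [eventually_gt_nhds (mmse_lt_of_mmseInv_lt hP hd hψ h1)] with ψ' hl
    exact (mmseInv_le ((mmseInv_nonneg ψ).trans h1.le) hl.le).trans_lt h2

theorem mercuryPower_eq (hP : ∫ x, x ^ 2 ∂P = 1) {g W : ℝ} (hg : 0 < g) (hW : 0 < W) :
    mercuryPower P g W = mmseInv P (1 / (W * g)) / g := by
  rw [mercuryPower, mercuryFactor]
  split_ifs with h
  · have e : W - 1 / g * (1 / (1 / (W * g)) - mmseInv P (1 / (W * g))) =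
        mmseInv P (1 / (W * g)) / g := by
      rw [one_div_one_div]; field_simp; ring
    rw [e, max_eq_left (div_nonneg (mmseInv_nonneg _) hg.le)]
  · rw [mmseInv_eq_zero hP (not_le.1 h).le, zero_div, mul_one, max_eq_right]
    have : W * g < 1 := by
      rw [not_le, lt_div_iff₀ (by positivity)] at h; linarith
    rw [sub_nonpos, le_div_iff₀ hg]; exact this.le

theorem mercuryPower_nonneg (g W : ℝ) : 0 ≤ mercuryPower P g W := le_max_right _ _

theorem mercuryPower_monotoneOn (hP : ∫ x, x ^ 2 ∂P = 1) {g : ℝ} (hg : 0 < g) :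
    MonotoneOn (mercuryPower P g) (Set.Ioi 0) := fun W hW V hV hle => by
  have hW' : 0 < W := hW
  have hV' : 0 < V := hV
  rw [mercuryPower_eq hP hg hW', mercuryPower_eq hP hg hV']
  refine div_le_div_of_nonneg_right (mmseInv_antitoneOn hP (Set.mem_Ioi.2 (by positivity))
    (Set.mem_Ioi.2 (by positivity)) ?_) hg.le
  gcongr

theorem mercuryPower_continuousOn (hP : ∫ x, x ^ 2 ∂P = 1) (hd : ∀ c, P ≠ Measure.dirac c) {g : ℝ}
    (hg : 0 < g) : ContinuousOn (mercuryPower P g) (Set.Ioi 0) := by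
  have h : ContinuousOn (fun W => mmseInv P (1 / (W * g)) / g) (Set.Ioi 0) := by
    refine ContinuousOn.div_const (fun W hW => ?_) g
    have hW' : 0 < W := hW
    refine (ContinuousAt.comp (f := fun W => 1 / (W * g))
      (continuousAt_mmseInv hP hd (by positivity)) ?_).continuousWithinAt
    exact continuousAt_const.div (by fun_prop) (by positivity)
  exact h.congr fun W hW => mercuryPower_eq hP hg hW

theorem mercuryPower_eq_zero (hP : ∫ x, x ^ 2 ∂P = 1) {g W : ℝ} (hg : 0 < g) (hW : 0 < W)
    (h : W ≤ 1 / g) : mercuryPower P g W = 0 := by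
  rw [mercuryPower_eq hP hg hW, mmseInv_eq_zero hP, zero_div]
  rw [le_div_iff₀ hg] at h
  rwa [le_div_iff₀ (by positivity), one_mul]

theorem exists_le_mercuryPower (hP : ∫ x, x ^ 2 ∂P = 1) (hd : ∀ c, P ≠ Measure.dirac c) {g : ℝ}
    (hg : 0 < g) (M : ℝ) : ∃ W, 0 < W ∧ M ≤ mercuryPower P g W := by
  have hM : 0 ≤ |M| * g := by positivity
  have hm := mmse_pos hP hd hM
  refine ⟨2 / (mmse P (|M| * g) * g), by positivity, ?_⟩
  rw [mercuryPower_eq hP hg (by positivity), le_div_iff₀ hg]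
  refine (mul_le_mul_of_nonneg_right (le_abs_self M) hg.le).trans
    (le_mmseInv hP hd hM (by positivity) ?_)
  have e : 1 / (2 / (mmse P (|M| * g) * g) * g) = mmse P (|M| * g) / 2 := by field_simp
  rw [e]; linarith

/-- The inverse MMSE at `ψ` is the strict maximizer of the Lagrangian of one stream, information
minus `ψ / 2` times the signal-to-noise ratio, whose derivative is half of `mmse - ψ`. -/
theorem scalarInfo_sqrt_sub_lt (hP : ∫ x, x ^ 2 ∂P = 1) (hd : ∀ c, P ≠ Measure.dirac c) {ψ γ : ℝ}
    (hψ : 0 < ψ) (hγ : 0 ≤ γ) (hne : γ ≠ mmseInv P ψ) :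
    scalarInfo P √γ - ψ / 2 * γ < scalarInfo P √(mmseInv P ψ) - ψ / 2 * mmseInv P ψ := by
  set q := mmseInv P ψ with hq
  have hq0 : 0 ≤ q := mmseInv_nonneg ψ
  set D : ℝ → ℝ := fun a => scalarInfo P a - ψ / 2 * a ^ 2 with hD
  have hDγ : ∀ {s : ℝ}, 0 ≤ s → D √s = scalarInfo P √s - ψ / 2 * s := fun hs => by
    simp only [hD, Real.sq_sqrt hs]
  have hcont : Continuous D := (continuous_scalarInfo hP).sub (by fun_prop)
  have hder : ∀ a, 0 < a → deriv D a = a * (mmse P (a ^ 2) - ψ) := fun a ha => by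
    rw [mmse_eq_meanSquareError hP, Real.sqrt_sq ha.le]
    have h := (hasDerivAt_scalarInfo hP ha).sub ((hasDerivAt_pow 2 a).const_mul (ψ / 2))
    refine (HasDerivAt.congr_deriv h ?_).deriv
    push_cast; ring
  rw [← hDγ hγ, ← hDγ hq0]
  rcases hne.lt_or_gt with h | h
  · have hmono : StrictMonoOn D (Set.Icc 0 √q) := by
      refine strictMonoOn_of_deriv_pos (convex_Icc _ _) hcont.continuousOn fun a ha => ?_
      rw [interior_Icc] at ha
      rw [hder a ha.1]
      have : a ^ 2 < q := by
        rw [← Real.sq_sqrt hq0]; exact pow_lt_pow_left₀ ha.2 ha.1.le two_ne_zero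
      exact mul_pos ha.1 (sub_pos.2 (lt_mmse_of_lt_mmseInv (sq_nonneg a) this))
    exact hmono ⟨Real.sqrt_nonneg _, Real.sqrt_le_sqrt h.le⟩ ⟨Real.sqrt_nonneg _, le_rfl⟩
      (Real.sqrt_lt_sqrt hγ h)
  · have hanti : StrictAntiOn D (Set.Ici √q) := by
      refine strictAntiOn_of_deriv_neg (convex_Ici _) hcont.continuousOn fun a ha => ?_
      rw [interior_Ici] at ha
      have ha0 : 0 < a := (Real.sqrt_nonneg q).trans_lt ha
      rw [hder a ha0]
      have : q < a ^ 2 := (Real.sqrt_lt' ha0).1 ha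
      exact mul_neg_of_pos_of_neg ha0 (sub_neg.2 (mmse_lt_of_mmseInv_lt hP hd hψ this))
    exact hanti (Set.mem_Ici.2 le_rfl) (Set.mem_Ici.2 (Real.sqrt_le_sqrt h.le))
      (Real.sqrt_lt_sqrt hq0 h)

theorem scalarInfo_lt_mercuryPower (hP : ∫ x, x ^ 2 ∂P = 1) (hd : ∀ c, P ≠ Measure.dirac c)
    {g W p : ℝ} (hg : 0 < g) (hW : 0 < W) (hp : 0 ≤ p) (hne : p ≠ mercuryPower P g W) :
    scalarInfo P √(g * p) - p / (2 * W) <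
      scalarInfo P √(g * mercuryPower P g W) - mercuryPower P g W / (2 * W) := by
  have e := mercuryPower_eq hP hg hW
  have e2 : g * mercuryPower P g W = mmseInv P (1 / (W * g)) := by rw [e]; field_simp
  have h := scalarInfo_sqrt_sub_lt hP hd (ψ := 1 / (W * g)) (by positivity)
    (mul_nonneg hg.le hp) (fun h => hne (by rw [← e2] at h; exact mul_left_cancel₀ hg.ne' h))
  rw [← e2] at h
  convert h using 2 <;> field_simp

end

/-! ### Lagrange duality -/

namespace HarvestingSystem

variable {K N J : ℕ} [NeZero J] (S : HarvestingSystem K N J)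

instance (k : Fin K) : IsProbabilityMeasure (S.input k) := S.input_prob k

theorem mem_pool_iff (j : Fin J) (n : Fin N) : n ∈ S.pool j ↔ S.poolOf n = j := by
  have hle : ∀ i, S.arrival i ≤ n → i ≤ S.poolOf n := fun i hi =>
    Finset.le_max' _ _ (by simpa using hi)
  have hmem : S.arrival (S.poolOf n) ≤ n :=
    (Finset.mem_filter.1 (Finset.max'_mem _ (S.arrivals_nonempty n))).2
  simp only [pool, Finset.mem_filter, Finset.mem_univ, true_and]
  constructor
  · rintro ⟨h1, h2⟩
    refine le_antisymm (le_of_not_gt fun h => ?_) (hle j h1)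
    exact (h2 _ h).not_ge hmem
  · rintro rfl
    exact ⟨hmem, fun i hi => lt_of_not_ge fun h => (hle i h).not_gt hi⟩

theorem arrival_mem_pool (j : Fin J) : S.arrival j ∈ S.pool j := by
  simp only [pool, Finset.mem_filter, Finset.mem_univ, true_and]
  exact ⟨le_rfl, fun i hi => S.arrival_strictMono hi⟩

/-- The throughput as a real number. -/
noncomputable def totalInfo (p : Fin K → Fin N → ℝ) : ℝ :=
  ∑ j, ∑ n ∈ S.pool j, ∑ k, scalarInfo (S.input k) √(S.gain k n * p k n)

theorem totalInfo_nonneg (p : Fin K → Fin N → ℝ) : 0 ≤ S.totalInfo p :=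
  Finset.sum_nonneg fun _ _ => Finset.sum_nonneg fun _ _ => Finset.sum_nonneg fun k _ =>
    scalarInfo_nonneg (S.input_unit_power k) _

theorem throughput_eq (p : Fin K → Fin N → ℝ) :
    S.throughput p = ENNReal.ofReal (S.totalInfo p) := by
  have h0 : ∀ n, 0 ≤ ∑ k, scalarInfo (S.input k) √(S.gain k n * p k n) := fun n =>
    Finset.sum_nonneg fun k _ => scalarInfo_nonneg (S.input_unit_power k) _
  rw [throughput, totalInfo, ENNReal.ofReal_sum_of_nonneg fun j _ =>
    Finset.sum_nonneg fun n _ => h0 n]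
  refine Finset.sum_congr rfl fun j _ => ?_
  rw [ENNReal.ofReal_sum_of_nonneg fun n _ => h0 n]
  exact Finset.sum_congr rfl fun n _ => mutualInformation_gaussianChannelLaw S.input_unit_power _

/-- The cost of an allocation at the prices `1 / (2 W)`, for water levels `W` that come from
multipliers of the energy causality constraints. -/
theorem sum_price_eq {W ρ : Fin J → ℝ}
    (hW : ∀ j, W j = 1 / (2 * S.symbolTime * ∑ l ∈ Finset.Ici j, ρ l)) (q : Fin K → Fin N → ℝ) :
    ∑ j, ∑ n ∈ S.pool j, ∑ k, q k n / (2 * W j) = ∑ l, ρ l * S.spent q (Finset.Iic l) := by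
  have h1 : ∀ j, ∑ n ∈ S.pool j, ∑ k, q k n / (2 * W j) =
      ∑ l ∈ Finset.Ici j, ρ l * (S.symbolTime * ∑ n ∈ S.pool j, ∑ k, q k n) := fun j => by
    have e : (2 * W j)⁻¹ = S.symbolTime * ∑ l ∈ Finset.Ici j, ρ l := by
      rw [hW j, one_div, mul_inv, inv_inv, ← mul_assoc, ← mul_assoc]; norm_num
    simp only [div_eq_mul_inv, e, ← Finset.sum_mul]
    ring
  simp only [h1, spent, Finset.mul_sum (Finset.Iic _)]
  exact Finset.sum_comm' fun j l => by simp

/-- A feasible mercury water-flowing allocation beats every other feasible allocation: it is the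
strict maximizer of the Lagrangian, which separates into the streams. -/
theorem totalInfo_lt_of_isMercuryWaterFlowing {W : Fin J → ℝ} {p q : Fin K → Fin N → ℝ}
    (h : S.IsMercuryWaterFlowing W p) (hq : S.Feasible q) (hne : q ≠ p) :
    S.totalInfo q < S.totalInfo p := by
  obtain ⟨⟨ρ, hρ, hslack, hpos, hW⟩, hp⟩ := h
  have hWpos : ∀ j, 0 < W j := fun j => by
    have := hpos j
    have := S.symbolTime_pos
    rw [hW j]; positivity
  have hle : ∀ j, ∀ n ∈ S.pool j, ∀ k,
      scalarInfo (S.input k) √(S.gain k n * q k n) - q k n / (2 * W j) ≤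
      scalarInfo (S.input k) √(S.gain k n * p k n) - p k n / (2 * W j) := fun j n hn k => by
    by_cases he : q k n = p k n
    · rw [he]
    · rw [hp j n hn k] at he ⊢
      exact (scalarInfo_lt_mercuryPower (S.input_unit_power k) (S.input_not_constant k)
        (S.gain_pos k n) (hWpos j) (hq.1 k n) he).le
  obtain ⟨k₀, n₀, hne₀⟩ : ∃ k n, q k n ≠ p k n := by
    by_contra! hall
    exact hne (funext fun k => funext fun n => hall k n)
  have hn₀ : n₀ ∈ S.pool (S.poolOf n₀) := (S.mem_pool_iff _ _).2 rfl
  have hlt : ∑ j, ∑ n ∈ S.pool j, ∑ k,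
      (scalarInfo (S.input k) √(S.gain k n * q k n) - q k n / (2 * W j)) <
      ∑ j, ∑ n ∈ S.pool j, ∑ k,
      (scalarInfo (S.input k) √(S.gain k n * p k n) - p k n / (2 * W j)) := by
    refine Finset.sum_lt_sum (fun j _ => Finset.sum_le_sum fun n hn => Finset.sum_le_sum
      fun k _ => hle j n hn k) ⟨S.poolOf n₀, Finset.mem_univ _, ?_⟩
    refine Finset.sum_lt_sum (fun n hn => Finset.sum_le_sum fun k _ => hle _ n hn k)
      ⟨n₀, hn₀, ?_⟩
    refine Finset.sum_lt_sum (fun k _ => hle _ n₀ hn₀ k) ⟨k₀, Finset.mem_univ _, ?_⟩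
    rw [hp _ n₀ hn₀ k₀] at hne₀ ⊢
    exact scalarInfo_lt_mercuryPower (S.input_unit_power k₀) (S.input_not_constant k₀)
      (S.gain_pos k₀ n₀) (hWpos _) (hq.1 k₀ n₀) hne₀
  simp only [Finset.sum_sub_distrib] at hlt
  rw [S.sum_price_eq hW, S.sum_price_eq hW] at hlt
  have hcost : ∑ l, ρ l * S.spent q (Finset.Iic l) ≤ ∑ l, ρ l * S.spent p (Finset.Iic l) := by
    refine Finset.sum_le_sum fun l _ => ?_
    have h1 := hslack l
    have h2 := mul_le_mul_of_nonneg_left (hq.2 l) (hρ l)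
    rw [mul_sub] at h1
    linarith
  unfold totalInfo
  linarith

theorem yieldsOptimum_of_isMercuryWaterFlowing {s : List (Epoch J)}
    (h : S.IsMercuryWaterFlowing (poolLevel s) (S.allocation s))
    (hf : S.Feasible (S.allocation s)) : S.YieldsOptimum s := by
  refine ⟨h, ⟨hf, fun q hq => ?_⟩, fun q hq => ?_⟩
  · rw [S.throughput_eq, S.throughput_eq]
    refine ENNReal.ofReal_le_ofReal ?_
    by_cases hne : q = S.allocation s
    · rw [hne]
    · exact (S.totalInfo_lt_of_isMercuryWaterFlowing h hq hne).le
  · by_contra hne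
    have hle := hq.2 _ hf
    rw [S.throughput_eq, S.throughput_eq,
      ENNReal.ofReal_le_ofReal_iff (S.totalInfo_nonneg q)] at hle
    exact hle.not_gt (S.totalInfo_lt_of_isMercuryWaterFlowing h hq.1 hne)

/-! ### Water levels -/

theorem spent_union (p : Fin K → Fin N → ℝ) {A B : Finset (Fin J)} (h : Disjoint A B) :
    S.spent p (A ∪ B) = S.spent p A + S.spent p B := by
  rw [spent, Finset.sum_union h, mul_add]; rfl

theorem harvested_union {A B : Finset (Fin J)} (h : Disjoint A B) :
    S.harvested (A ∪ B) = S.harvested A + S.harvested B :=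
  Finset.sum_union h

theorem spent_levelPower_mono (A : Finset (Fin J)) {W V : ℝ} (hW : 0 < W) (h : W ≤ V) :
    S.spent (S.levelPower W) A ≤ S.spent (S.levelPower V) A :=
  mul_le_mul_of_nonneg_left (Finset.sum_le_sum fun _ _ => Finset.sum_le_sum fun n _ =>
    Finset.sum_le_sum fun k _ => mercuryPower_monotoneOn (S.input_unit_power k) (S.gain_pos k n)
      hW (hW.trans_le h) h) S.symbolTime_pos.le

theorem spent_levelPower_continuousOn (A : Finset (Fin J)) :
    ContinuousOn (fun W => S.spent (S.levelPower W) A) (Set.Ioi 0) := by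
  refine continuousOn_const.mul (continuousOn_finsetSum _ fun _ _ => continuousOn_finsetSum _
    fun n _ => continuousOn_finsetSum _ fun k _ => ?_)
  exact mercuryPower_continuousOn (S.input_unit_power k) (S.input_not_constant k) (S.gain_pos k n)

theorem exists_isWaterLevel [NeZero K] {A : Finset (Fin J)} (hA : A.Nonempty) :
    ∃ W, S.IsWaterLevel A W := by
  obtain ⟨j, hj⟩ := hA
  have hH : 0 ≤ S.harvested A := Finset.sum_nonneg fun j _ => S.energy_nonneg j
  -- a level below all the inverse gains, at which no power is spent
  set G := 1 + ∑ k, ∑ n, S.gain k n with hG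
  have hgG : ∀ k n, S.gain k n ≤ G := fun k n => by
    have h1 : S.gain k n ≤ ∑ n, S.gain k n :=
      Finset.single_le_sum (fun n _ => (S.gain_pos k n).le) (Finset.mem_univ n)
    have h2 : ∑ n, S.gain k n ≤ ∑ k, ∑ n, S.gain k n :=
      Finset.single_le_sum (f := fun k => ∑ n, S.gain k n)
        (fun k _ => Finset.sum_nonneg fun n _ => (S.gain_pos k n).le) (Finset.mem_univ k)
    linarith
  have hG0 : 0 < G := by
    have : 0 ≤ ∑ k, ∑ n, S.gain k n :=
      Finset.sum_nonneg fun k _ => Finset.sum_nonneg fun n _ => (S.gain_pos k n).le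
    linarith
  have hlow : S.spent (S.levelPower (1 / G)) A = 0 := by
    have h : ∀ k n, S.levelPower (1 / G) k n = 0 := fun k n =>
      mercuryPower_eq_zero (S.input_unit_power k) (S.gain_pos k n) (by positivity)
        (one_div_le_one_div_of_le (S.gain_pos k n) (hgG k n))
    simp only [spent, h, Finset.sum_const_zero, mul_zero]
  -- a level at which a single stream at a single channel use spends all the energy
  obtain ⟨V, hV, hVle⟩ := exists_le_mercuryPower (S.input_unit_power 0) (S.input_not_constant 0)
    (S.gain_pos 0 (S.arrival j)) (S.harvested A / S.symbolTime)
  have hp : ∀ k n, 0 ≤ S.levelPower V k n := fun k n => mercuryPower_nonneg _ _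
  have hhigh : S.harvested A ≤ S.spent (S.levelPower V) A := by
    rw [div_le_iff₀' S.symbolTime_pos] at hVle
    refine hVle.trans (mul_le_mul_of_nonneg_left ?_ S.symbolTime_pos.le)
    calc S.levelPower V 0 (S.arrival j) ≤ ∑ k, S.levelPower V k (S.arrival j) :=
          Finset.single_le_sum (fun k _ => hp k _) (Finset.mem_univ _)
      _ ≤ ∑ n ∈ S.pool j, ∑ k, S.levelPower V k n :=
          Finset.single_le_sum (f := fun n => ∑ k, S.levelPower V k n)
            (fun n _ => Finset.sum_nonneg fun k _ => hp k n) (S.arrival_mem_pool j)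
      _ ≤ ∑ j ∈ A, ∑ n ∈ S.pool j, ∑ k, S.levelPower V k n :=
          Finset.single_le_sum (f := fun j => ∑ n ∈ S.pool j, ∑ k, S.levelPower V k n)
            (fun j _ => Finset.sum_nonneg fun n _ => Finset.sum_nonneg fun k _ => hp k n) hj
  obtain ⟨W, hW, he⟩ := isPreconnected_Ioi.intermediate_value (Set.mem_Ioi.2 (by positivity))
    (Set.mem_Ioi.2 hV) (S.spent_levelPower_continuousOn A)
    (show S.harvested A ∈ Set.Icc (S.spent (S.levelPower (1 / G)) A) _ from ⟨hlow ▸ hH, hhigh⟩)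
  exact ⟨W, hW, he⟩

/-- If raising the level does not raise the energy spent in `A`, then it changes nothing in any part
of `A`. -/
theorem spent_levelPower_le_of_le {A X : Finset (Fin J)} (hX : X ⊆ A) {W V : ℝ} (hW : 0 < W)
    (h : W ≤ V) (hle : S.spent (S.levelPower V) A ≤ S.spent (S.levelPower W) A) :
    S.spent (S.levelPower V) X ≤ S.spent (S.levelPower W) X := by
  have e : X ∪ A \ X = A := Finset.union_sdiff_of_subset hX
  rw [← e, S.spent_union _ Finset.disjoint_sdiff, S.spent_union _ Finset.disjoint_sdiff] at hle
  have := S.spent_levelPower_mono (A \ X) hW h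
  linarith

/-- All water levels of `A` yield the same powers in `A`. -/
theorem IsWaterLevel.spent_le {S : HarvestingSystem K N J} {A X : Finset (Fin J)} {W V : ℝ}
    (hW : S.IsWaterLevel A W) (hV : S.IsWaterLevel A V) (hX : X ⊆ A) :
    S.spent (S.levelPower V) X ≤ S.spent (S.levelPower W) X := by
  rcases le_total V W with h | h
  · exact S.spent_levelPower_mono X hV.1 h
  · exact S.spent_levelPower_le_of_le hX hW.1 h (hV.2.trans hW.2.symm).le

/-- The water level of a set of pools need not be unique, but whether it satisfies the energy
causality constraints does not depend on its choice. -/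
theorem SatisfiesECCWithin.of_isWaterLevel {S : HarvestingSystem K N J} {A : Finset (Fin J)}
    {W V : ℝ} (h : S.SatisfiesECCWithin A W) (hW : S.IsWaterLevel A W)
    (hV : S.IsWaterLevel A V) : S.SatisfiesECCWithin A V := fun l hl =>
  (hW.spent_le hV (Finset.filter_subset _ _)).trans (h l hl)

section Merge

variable {S} {A B X : Finset (Fin J)} {Wa Wb Wc : ℝ}

/-- The earlier epoch does not gain by a merge: if the common level were higher than both levels,
then both epochs would already spend at the common level what they spend at their own. -/
theorem IsWaterLevel.spent_merge_le_left (ha : S.IsWaterLevel A Wa) (hb : S.IsWaterLevel B Wb)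
    (hc : S.IsWaterLevel (A ∪ B) Wc) (hd : Disjoint A B) (hlt : Wb < Wa) (hX : X ⊆ A) :
    S.spent (S.levelPower Wc) X ≤ S.spent (S.levelPower Wa) X := by
  rcases le_total Wc Wa with h | h
  · exact S.spent_levelPower_mono X hc.1 h
  · refine S.spent_levelPower_le_of_le hX ha.1 h ?_
    have h1 := S.spent_levelPower_mono B hb.1 (hlt.le.trans h)
    have h2 := hc.2
    rw [S.spent_union _ hd, S.harvested_union hd] at h2
    rw [ha.2]; rw [hb.2] at h1
    linarith

theorem IsWaterLevel.spent_merge_ge_right (ha : S.IsWaterLevel A Wa) (hb : S.IsWaterLevel B Wb)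
    (hc : S.IsWaterLevel (A ∪ B) Wc) (hd : Disjoint A B) (hlt : Wb < Wa) (hX : X ⊆ B) :
    S.spent (S.levelPower Wb) X ≤ S.spent (S.levelPower Wc) X := by
  rcases le_total Wb Wc with h | h
  · exact S.spent_levelPower_mono X hb.1 h
  · refine S.spent_levelPower_le_of_le hX hc.1 h ?_
    have h1 := S.spent_levelPower_mono A hc.1 (h.trans hlt.le)
    have h2 := hc.2
    rw [S.spent_union _ hd, S.harvested_union hd] at h2
    rw [hb.2]; rw [ha.2] at h1
    linarith

/-- Merging two consecutive epochs of decreasing levels keeps the energy causality constraints: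
energy moves from the earlier epoch to the later one. -/
theorem SatisfiesECCWithin.merge (ha : S.IsWaterLevel A Wa) (hb : S.IsWaterLevel B Wb)
    (hc : S.IsWaterLevel (A ∪ B) Wc) (hAB : ∀ i ∈ A, ∀ j ∈ B, i < j) (hlt : Wb < Wa)
    (hea : S.SatisfiesECCWithin A Wa) (heb : S.SatisfiesECCWithin B Wb) :
    S.SatisfiesECCWithin (A ∪ B) Wc := by
  have hd : Disjoint A B := Finset.disjoint_left.2 fun i hi hi' => (hAB i hi i hi').false
  intro l hl
  rcases Finset.mem_union.1 hl with hl | hl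
  · have e : (A ∪ B).filter (· ≤ l) = A.filter (· ≤ l) := by
      rw [Finset.filter_union, (Finset.filter_eq_empty_iff (s := B)).2 fun {j} hj =>
        (hAB l hl j hj).not_ge, Finset.union_empty]
    rw [e]
    exact (ha.spent_merge_le_left hb hc hd hlt (Finset.filter_subset _ _)).trans (hea l hl)
  · -- equivalently, the pools after `l` spend at least what they harvest
    have h1 := ha.spent_merge_ge_right hb hc hd hlt (Finset.filter_subset (¬ · ≤ l) B)
    have h2 := heb l hl
    have hdl : Disjoint (B.filter (· ≤ l)) (B.filter (¬ · ≤ l)) :=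
      Finset.disjoint_filter_filter_not _ _ _
    have hbl := hb.2
    rw [← Finset.filter_union_filter_not_eq (· ≤ l) B, S.spent_union _ hdl,
      S.harvested_union hdl] at hbl
    have e : (A ∪ B).filter (¬ · ≤ l) = B.filter (¬ · ≤ l) := by
      rw [Finset.filter_union, (Finset.filter_eq_empty_iff (s := A)).2 fun {i} hi =>
        not_not.2 (hAB i hi l hl).le, Finset.empty_union]
    have hcl := hc.2
    rw [← Finset.filter_union_filter_not_eq (· ≤ l) (A ∪ B),
      S.spent_union _ (Finset.disjoint_filter_filter_not _ _ _),
      S.harvested_union (Finset.disjoint_filter_filter_not _ _ _), e] at hcl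
    linarith

end Merge

end HarvestingSystem

/-! ### Lists of consecutive epochs -/

/-- The pools `j` with `a ≤ j < b`. -/
def poolSegment (J a b : ℕ) : Finset (Fin J) :=
  Finset.univ.filter fun j => a ≤ (j : ℕ) ∧ (j : ℕ) < b

/-- The epochs in a list are consecutive, the first one starts at the pool `a`, the last one ends
before the pool `b`, and an epoch `e` that consists of the pools `i ≤ j < m` satisfies `Q i m e`. -/
inductive ConsecutiveEpochs {J : ℕ} (Q : ℕ → ℕ → Epoch J → Prop) : List (Epoch J) → ℕ → ℕ → Prop
  | nil (a : ℕ) : ConsecutiveEpochs Q [] a a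
  | cons {a m b : ℕ} {e : Epoch J} {s : List (Epoch J)} :
      Q a m e → ConsecutiveEpochs Q s m b → ConsecutiveEpochs Q (e :: s) a b

section

variable {J : ℕ}

theorem mem_poolSegment {a b : ℕ} {j : Fin J} :
    j ∈ poolSegment J a b ↔ a ≤ (j : ℕ) ∧ (j : ℕ) < b := by
  simp [poolSegment]

theorem poolSegment_union {a m b : ℕ} (h1 : a ≤ m) (h2 : m ≤ b) :
    poolSegment J a m ∪ poolSegment J m b = poolSegment J a b := by
  ext j; simp only [Finset.mem_union, mem_poolSegment]; omega

theorem poolSegment_lt_poolSegment {a m b : ℕ} :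
    ∀ i ∈ poolSegment J a m, ∀ j ∈ poolSegment J m b, i < j := by
  intro i hi j hj
  rw [mem_poolSegment] at hi hj
  exact Fin.lt_def.2 (hi.2.trans_le hj.1)

theorem disjoint_poolSegment {a m b : ℕ} : Disjoint (poolSegment J a m) (poolSegment J m b) :=
  Finset.disjoint_left.2 fun i hi hi' => (poolSegment_lt_poolSegment i hi i hi').false

theorem poolSegment_succ (j : Fin J) : poolSegment J j (j + 1) = {j} := by
  ext i; rw [mem_poolSegment, Finset.mem_singleton, Fin.ext_iff]; omega

namespace ConsecutiveEpochs

variable {Q Q' : ℕ → ℕ → Epoch J → Prop} {s t : List (Epoch J)} {a b m : ℕ}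

theorem append_iff :
    ConsecutiveEpochs Q (s ++ t) a b ↔
      ∃ m, ConsecutiveEpochs Q s a m ∧ ConsecutiveEpochs Q t m b := by
  constructor
  · intro h
    induction s generalizing a with
    | nil => exact ⟨a, .nil a, h⟩
    | cons e s ih =>
      cases h with
      | cons he h =>
        obtain ⟨m, h1, h2⟩ := ih h
        exact ⟨m, .cons he h1, h2⟩
  · rintro ⟨m, h1, h2⟩
    induction h1 with
    | nil => exact h2
    | cons he _ ih => exact .cons he (ih h2)

theorem cons_iff {e : Epoch J} :
    ConsecutiveEpochs Q (e :: s) a b ↔ ∃ m, Q a m e ∧ ConsecutiveEpochs Q s m b :=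
  ⟨fun h => by cases h with | cons he h => exact ⟨_, he, h⟩, fun ⟨_, he, h⟩ => .cons he h⟩

theorem nil_iff : ConsecutiveEpochs Q [] a b ↔ a = b :=
  ⟨fun h => by cases h; rfl, fun h => h ▸ .nil a⟩

theorem mono (hQ : ∀ a b e, Q a b e → Q' a b e) (h : ConsecutiveEpochs Q s a b) :
    ConsecutiveEpochs Q' s a b := by
  induction h with
  | nil a => exact .nil a
  | cons he _ ih => exact .cons (hQ _ _ _ he) ih

theorem le (hQ : ∀ a b e, Q a b e → a < b) (h : ConsecutiveEpochs Q s a b) : a ≤ b := by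
  induction h with
  | nil a => exact le_rfl
  | cons he _ ih => exact (hQ _ _ _ he).le.trans ih

/-- The epoch that contains a given pool. -/
theorem exists_split (h : ConsecutiveEpochs Q s a b) {j : ℕ} (h1 : a ≤ j) (h2 : j < b) :
    ∃ l e r i m, s = l ++ e :: r ∧ ConsecutiveEpochs Q l a i ∧ Q i m e ∧
      ConsecutiveEpochs Q r m b ∧ i ≤ j ∧ j < m := by
  induction h with
  | nil a => omega
  | @cons a m b e s he hs ih =>
    rcases lt_or_ge j m with hj | hj
    · exact ⟨[], e, s, a, m, rfl, .nil a, he, hs, h1, hj⟩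
    · obtain ⟨l, e', r, i, m', hs', hl, he', hr, hi, hm⟩ := ih hj h2
      exact ⟨e :: l, e', r, i, m', by rw [hs']; rfl, .cons he hl, he', hr, hi, hm⟩

end ConsecutiveEpochs

end

namespace HarvestingSystem

variable {K N J : ℕ} [NeZero J] (S : HarvestingSystem K N J)

/-- The pools `a ≤ j < b` form an epoch `e` with a water level at which the energy causality
constraints within the epoch hold. -/
structure IsEpoch (a b : ℕ) (e : Epoch J) : Prop where
  lt : a < b
  le : b ≤ J
  pools_eq : e.pools = poolSegment J a b
  isWaterLevel : S.IsWaterLevel e.pools e.level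
  satisfiesECC : S.SatisfiesECCWithin e.pools e.level

variable {S}

/-- Within a single pool, the energy causality constraint is the equation for the water level. -/
theorem satisfiesECCWithin_singleton {j : Fin J} {W : ℝ} (h : S.IsWaterLevel {j} W) :
    S.SatisfiesECCWithin {j} W := fun l hl => by
  rw [Finset.mem_singleton.1 hl, Finset.filter_true_of_mem (by simp)]
  exact h.2.le

theorem IsEpoch.merge {a m b : ℕ} {e f g : Epoch J} (he : S.IsEpoch a m e) (hf : S.IsEpoch m b f)
    (hlt : f.level < e.level) (hg : g.pools = e.pools ∪ f.pools)
    (hW : S.IsWaterLevel g.pools g.level) : S.IsEpoch a b g where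
  lt := he.lt.trans hf.lt
  le := hf.le
  pools_eq := by rw [hg, he.pools_eq, hf.pools_eq, poolSegment_union he.lt.le hf.lt.le]
  isWaterLevel := hW
  satisfiesECC := by
    rw [hg] at hW ⊢
    refine he.satisfiesECC.merge he.isWaterLevel hf.isWaterLevel hW ?_ hlt hf.satisfiesECC
    rw [he.pools_eq, hf.pools_eq]
    exact poolSegment_lt_poolSegment

theorem IsEpoch.not_mem_of_consecutive {s : List (Epoch J)} {a b : ℕ}
    (h : ConsecutiveEpochs S.IsEpoch s a b) {e : Epoch J} (he : e ∈ s) {j : Fin J}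
    (hj : b ≤ (j : ℕ)) : j ∉ e.pools := by
  induction h with
  | nil => simp at he
  | cons hf hs ih =>
    rcases List.mem_cons.1 he with rfl | he
    · rw [hf.pools_eq, mem_poolSegment]
      have := hs.le fun _ _ _ h => h.lt
      omega
    · exact ih he hj

theorem poolLevel_eq {l r : List (Epoch J)} {e : Epoch J} {a b : ℕ}
    (hl : ConsecutiveEpochs S.IsEpoch l 0 a) (he : S.IsEpoch a b e) {j : Fin J}
    (hj : j ∈ e.pools) : poolLevel (l ++ e :: r) j = e.level := by
  have h : (l.find? fun e => decide (j ∈ e.pools)) = none := by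
    rw [List.find?_eq_none]
    intro e' he'
    have := IsEpoch.not_mem_of_consecutive hl he' (j := j)
      (by rw [he.pools_eq, mem_poolSegment] at hj; exact hj.1)
    simpa using this
  simp [poolLevel, List.find?_append, h, hj]

theorem spent_allocation_eq {l r : List (Epoch J)} {e : Epoch J} {a b : ℕ}
    (hl : ConsecutiveEpochs S.IsEpoch l 0 a) (he : S.IsEpoch a b e) {X : Finset (Fin J)}
    (hX : X ⊆ e.pools) :
    S.spent (S.allocation (l ++ e :: r)) X = S.spent (S.levelPower e.level) X := by
  refine congrArg (S.symbolTime * ·) (Finset.sum_congr rfl fun j hj => Finset.sum_congr rfl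
    fun n hn => Finset.sum_congr rfl fun k _ => ?_)
  rw [allocation, levelPower, (S.mem_pool_iff j n).1 hn, poolLevel_eq hl he (hX hj)]

/-- At the end of each epoch, all the energy harvested so far has been spent. -/
theorem spent_prefix_eq {l r : List (Epoch J)} {a : ℕ}
    (hl : ConsecutiveEpochs S.IsEpoch l 0 a) :
    S.spent (S.allocation (l ++ r)) (poolSegment J 0 a) = S.harvested (poolSegment J 0 a) := by
  induction l using List.reverseRecOn generalizing r a with
  | nil =>
    rw [ConsecutiveEpochs.nil_iff] at hl
    subst hl
    simp [poolSegment, spent, harvested]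
  | append_singleton l e ih =>
    obtain ⟨m, hl', h⟩ := ConsecutiveEpochs.append_iff.1 hl
    obtain ⟨m', he, h⟩ := ConsecutiveEpochs.cons_iff.1 h
    rw [ConsecutiveEpochs.nil_iff] at h
    subst h
    have h1 := ih (r := e :: r) hl'
    have h2 := spent_allocation_eq (r := r) hl' he subset_rfl
    have hW := he.isWaterLevel.2
    rw [he.pools_eq] at h2 hW
    rw [← poolSegment_union (Nat.zero_le m) he.lt.le, S.spent_union _ disjoint_poolSegment,
      S.harvested_union disjoint_poolSegment, List.append_assoc, List.singleton_append, h1, h2, hW]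

theorem Iic_eq_poolSegment (j : Fin J) : Finset.Iic j = poolSegment J 0 (j + 1) := by
  ext i; rw [Finset.mem_Iic, mem_poolSegment, Fin.le_def]; omega

theorem feasible_allocation {s : List (Epoch J)} (h : ConsecutiveEpochs S.IsEpoch s 0 J) :
    S.Feasible (S.allocation s) := by
  refine ⟨fun k n => mercuryPower_nonneg _ _, fun j => ?_⟩
  obtain ⟨l, e, r, i, m, rfl, hl, he, -, hi, hm⟩ := h.exists_split (Nat.zero_le j) j.2
  have e1 : Finset.Iic j = poolSegment J 0 i ∪ e.pools.filter (· ≤ j) := by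
    rw [he.pools_eq]
    ext x
    simp only [Finset.mem_Iic, Finset.mem_union, Finset.mem_filter, mem_poolSegment, Fin.le_def]
    omega
  have hd : Disjoint (poolSegment J 0 i) (e.pools.filter (· ≤ j)) := by
    rw [he.pools_eq]
    exact disjoint_poolSegment.mono_right (Finset.filter_subset _ _)
  have hj : j ∈ e.pools := by rw [he.pools_eq, mem_poolSegment]; exact ⟨hi, hm⟩
  rw [e1, S.spent_union _ hd, S.harvested_union hd, spent_prefix_eq hl,
    spent_allocation_eq hl he (Finset.filter_subset _ _)]
  exact add_le_add_right (he.satisfiesECC j hj) _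

/-- Between consecutive pools the level is constant, or it does not decrease and all the energy
harvested so far has been spent. -/
theorem level_step {s : List (Epoch J)} (h : ConsecutiveEpochs S.IsEpoch s 0 J)
    (hs : NDAHalted s) (j : Fin J) :
    (∃ hj : (j : ℕ) + 1 < J, poolLevel s j = poolLevel s ⟨j + 1, hj⟩) ∨
      (S.spent (S.allocation s) (Finset.Iic j) = S.harvested (Finset.Iic j) ∧
        ∀ hj : (j : ℕ) + 1 < J, poolLevel s j ≤ poolLevel s ⟨j + 1, hj⟩) := by
  obtain ⟨l, e, r, i, m, rfl, hl, he, hr, hi, hm⟩ := h.exists_split (Nat.zero_le j) j.2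
  have hj : j ∈ e.pools := by rw [he.pools_eq, mem_poolSegment]; exact ⟨hi, hm⟩
  rcases (Nat.succ_le_of_lt hm).lt_or_eq with hlt | heq
  · have hJ : (j : ℕ) + 1 < J := lt_of_lt_of_le hlt he.le
    have hj' : (⟨j + 1, hJ⟩ : Fin J) ∈ e.pools := by
      rw [he.pools_eq, mem_poolSegment]; exact ⟨by simp only; omega, hlt⟩
    exact Or.inl ⟨hJ, by rw [poolLevel_eq hl he hj, poolLevel_eq hl he hj']⟩
  · have hle : ConsecutiveEpochs S.IsEpoch (l ++ [e]) 0 m :=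
      ConsecutiveEpochs.append_iff.2 ⟨i, hl, .cons he (.nil m)⟩
    refine Or.inr ⟨?_, fun hJ => ?_⟩
    · have := spent_prefix_eq (r := r) hle
      rw [List.append_assoc, List.singleton_append] at this
      rw [Iic_eq_poolSegment, show (j : ℕ) + 1 = m from heq, this]
    · cases hr with
      | nil => exact absurd hJ (by omega)
      | @cons _ m' _ f r hf hr =>
        have hj' : (⟨j + 1, hJ⟩ : Fin J) ∈ f.pools := by
          rw [hf.pools_eq, mem_poolSegment]
          have := hf.lt
          constructor <;> simp only <;> omega
        have h2 := poolLevel_eq (r := r) hle hf hj'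
        rw [List.append_assoc, List.singleton_append] at h2
        rw [poolLevel_eq hl he hj, h2]
        exact hs l r e f rfl

theorem poolLevel_pos {s : List (Epoch J)} (h : ConsecutiveEpochs S.IsEpoch s 0 J) (j : Fin J) :
    0 < poolLevel s j := by
  obtain ⟨l, e, r, i, m, rfl, hl, he, -, hi, hm⟩ := h.exists_split (Nat.zero_le j) j.2
  rw [poolLevel_eq hl he (by rw [he.pools_eq, mem_poolSegment]; exact ⟨hi, hm⟩)]
  exact he.isWaterLevel.1

/-- Consecutive epochs with nondecreasing levels solve the problem: the multiplier of the constraint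
at the end of a pool is proportional to the drop of the inverse level there, and this drop vanishes
unless all the energy harvested so far has been spent. -/
theorem yieldsOptimum_of_consecutive {s : List (Epoch J)}
    (h : ConsecutiveEpochs S.IsEpoch s 0 J) (hs : NDAHalted s) : S.YieldsOptimum s := by
  refine S.yieldsOptimum_of_isMercuryWaterFlowing ⟨?_, fun j n hn k => ?_⟩ (feasible_allocation h)
  swap
  · rw [allocation, (S.mem_pool_iff j n).1 hn]
  have hT := S.symbolTime_pos
  -- the inverse level, extended by zero past the last pool
  set v : ℕ → ℝ := fun i => if hi : i < J then 1 / poolLevel s ⟨i, hi⟩ else 0 with hv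
  have hvj : ∀ j : Fin J, v j = 1 / poolLevel s j := fun j => by simp [hv]
  have hsum : ∀ j : Fin J, ∑ l ∈ Finset.Ici j, (v l - v (l + 1)) / (2 * S.symbolTime) =
      1 / (2 * S.symbolTime * poolLevel s j) := fun j => by
    have h1 : ∑ l ∈ Finset.Ici j, (v l - v (l + 1)) = v j := by
      have h2 : ∑ l ∈ Finset.Ici j, (v l - v (l + 1)) =
          ∑ i ∈ (Finset.Ici j).map Fin.valEmbedding, (v i - v (i + 1)) := by
        rw [Finset.sum_map]; rfl
      have h3 : v J = 0 := by simp [hv]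
      have h4 := Finset.sum_Ico_sub v j.2.le
      rw [h2, Fin.map_valEmbedding_Ici, ← neg_inj, ← Finset.sum_neg_distrib]
      simp only [neg_sub]
      rw [h4, h3, zero_sub]
    rw [← Finset.sum_div, h1, hvj, div_div, mul_comm]
  have hpos : ∀ j, 0 < poolLevel s j := poolLevel_pos h
  refine ⟨fun l => (v l - v (l + 1)) / (2 * S.symbolTime), fun l => ?_, fun l => ?_, fun j => ?_,
    fun j => ?_⟩
  · refine div_nonneg (sub_nonneg.2 ?_) (by positivity)
    rw [hvj]
    by_cases hl : (l : ℕ) + 1 < J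
    · simp only [hv, hl, dif_pos]
      refine one_div_le_one_div_of_le (hpos l) ?_
      rcases level_step h hs l with ⟨_, h1⟩ | ⟨_, h1⟩
      · exact h1.le
      · exact h1 hl
    · simp only [hv, hl, dif_neg, not_false_eq_true]
      exact (one_div_pos.2 (hpos l)).le
  · rcases level_step h hs l with ⟨hl, h1⟩ | ⟨h1, _⟩
    · have : v (l + 1) = v l := by rw [hvj, h1]; simp [hv, hl]
      simp [this]
    · rw [h1, sub_self, mul_zero]
  · have := hpos j
    rw [hsum]; positivity
  · have := hpos j
    rw [hsum]; field_simp

end HarvestingSystem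

/-! ### Correctness of the two algorithms -/

theorem not_forall_succ_lt {α : Type*} (m : α → ℕ) (f : ℕ → α) :
    ¬ ∀ i, m (f (i + 1)) < m (f i) := fun h =>
  not_strictAnti_of_wellFoundedLT (fun i => m (f i)) (strictAnti_nat_of_succ_lt h)

namespace HarvestingSystem

variable {K N J : ℕ} [NeZero J] {S : HarvestingSystem K N J}

theorem consecutive_of_pools_eq_drop {s : List (Epoch J)} {a : ℕ} (ha : a ≤ J)
    (hp : s.map Epoch.pools = ((List.finRange J).drop a).map fun j => {j})
    (hW : ∀ e ∈ s, S.IsWaterLevel e.pools e.level) : ConsecutiveEpochs S.IsEpoch s a J := by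
  induction s generalizing a with
  | nil =>
    have h : J - a = 0 := by simpa using congrArg List.length hp.symm
    replace h : J ≤ a := Nat.sub_eq_zero_iff_le.1 h
    exact ConsecutiveEpochs.nil_iff.2 (ha.antisymm h)
  | cons e s ih =>
    have hlt : a < J := by
      by_contra hge
      rw [List.drop_eq_nil_of_le (by simpa using hge)] at hp
      simp at hp
    rw [List.drop_eq_getElem_cons (by simpa using hlt), List.map_cons, List.map_cons,
      List.cons.injEq, List.getElem_finRange] at hp
    have he : e.pools = {⟨a, hlt⟩} := by rw [hp.1]; rfl
    have hWe := hW e List.mem_cons_self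
    refine .cons ⟨Nat.lt_succ_self a, hlt, ?_, hWe, ?_⟩
      (ih hlt hp.2 fun f hf => hW f (List.mem_cons_of_mem _ hf))
    · rw [he, ← poolSegment_succ]
    · rw [he] at hWe ⊢
      exact satisfiesECCWithin_singleton hWe

theorem NDAStart.consecutive {s : List (Epoch J)} (h : S.NDAStart s) :
    ConsecutiveEpochs S.IsEpoch s 0 J :=
  consecutive_of_pools_eq_drop (Nat.zero_le J) (by simpa using h.1) h.2

theorem NDAStep.consecutive {s t : List (Epoch J)} (h : S.NDAStep s t)
    (hs : ConsecutiveEpochs S.IsEpoch s 0 J) : ConsecutiveEpochs S.IsEpoch t 0 J := by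
  obtain ⟨l, r, a, b, c, rfl, hlt, hc, hW, rfl⟩ := h
  obtain ⟨x, hl, h⟩ := ConsecutiveEpochs.append_iff.1 hs
  obtain ⟨y, ha, h⟩ := ConsecutiveEpochs.cons_iff.1 h
  obtain ⟨z, hb, h⟩ := ConsecutiveEpochs.cons_iff.1 h
  exact ConsecutiveEpochs.append_iff.2 ⟨x, hl, .cons (ha.merge hb hlt hc hW) h⟩

theorem NDAStep.length_lt {s t : List (Epoch J)} (h : S.NDAStep s t) : t.length < s.length := by
  obtain ⟨l, r, a, b, c, rfl, -, -, -, rfl⟩ := h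
  simp

theorem exists_ndaStart [NeZero K] (S : HarvestingSystem K N J) : ∃ s, S.NDAStart s := by
  choose W hW using fun j : Fin J => S.exists_isWaterLevel (Finset.singleton_nonempty j)
  refine ⟨(List.finRange J).map fun j => ⟨{j}, W j⟩, by simp, fun e he => ?_⟩
  obtain ⟨j, -, rfl⟩ := List.mem_map.1 he
  exact hW j

theorem nda_totallyCorrect [NeZero K] (S : HarvestingSystem K N J) :
    TotallyCorrect S.NDAStart S.NDAStep NDAHalted S.YieldsOptimum := by
  refine ⟨S.exists_ndaStart, fun f _ hf => not_forall_succ_lt List.length f fun i =>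
    (hf i).length_lt, fun s₀ s h₀ hrun => ?_⟩
  have hs : ConsecutiveEpochs S.IsEpoch s 0 J := by
    induction hrun with
    | refl => exact h₀.consecutive
    | tail _ hstep ih => exact hstep.consecutive ih
  refine ⟨yieldsOptimum_of_consecutive hs, fun hh => ?_⟩
  simp only [NDAHalted, not_forall, not_le] at hh
  obtain ⟨l, r, a, b, rfl, hlt⟩ := hh
  obtain ⟨x, -, h⟩ := ConsecutiveEpochs.append_iff.1 hs
  obtain ⟨y, ha, -⟩ := ConsecutiveEpochs.cons_iff.1 h
  have hne : (a.pools ∪ b.pools).Nonempty := by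
    refine ⟨⟨x, ha.lt.trans_le ha.le⟩, Finset.mem_union_left _ ?_⟩
    rw [ha.pools_eq, mem_poolSegment]
    exact ⟨le_rfl, ha.lt⟩
  obtain ⟨W, hW⟩ := S.exists_isWaterLevel hne
  exact ⟨_, l, r, a, b, ⟨a.pools ∪ b.pools, W⟩, rfl, hlt, rfl, hW, rfl⟩

/-- No epoch that starts at the pool `a` and ends after the pools `j < b` satisfies the energy
causality constraints. -/
def NoLongerEpoch (S : HarvestingSystem K N J) (a b : ℕ) : Prop :=
  ∀ c, b < c → c ≤ J → ∀ W, S.IsWaterLevel (poolSegment J a c) W →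
    ¬ S.SatisfiesECCWithin (poolSegment J a c) W

/-- The epochs found by the forward search algorithm cannot be prolonged; the candidate is nonempty
unless all pools are in some epoch, and longer candidates have been rejected. -/
structure FSAInvariant (S : HarvestingSystem K N J) (s : FSAState J) : Prop where
  upper_le : s.upper ≤ J
  found : ConsecutiveEpochs (fun a b e => S.IsEpoch a b e ∧ S.NoLongerEpoch a b) s.found 0 s.first
  first_lt : s.first = J ∨ s.first < s.upper
  rejected : S.NoLongerEpoch s.first s.upper

theorem FSAInvariant.of_start {s : FSAState J} (h : FSAStart s) : S.FSAInvariant s := by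
  subst h
  exact ⟨le_rfl, .nil 0, Or.inr (NeZero.pos J), fun c h1 h2 => absurd h2 h1.not_ge⟩

theorem FSAStep.invariant {s t : FSAState J} (h : S.FSAStep s t) (hs : S.FSAInvariant s) :
    S.FSAInvariant t := by
  obtain ⟨hlt, W, hW, ⟨hn, rfl⟩ | ⟨hy, rfl⟩⟩ := h
  · -- a candidate that consists of a single pool is never rejected
    have hne : s.first + 1 ≠ s.upper := fun he => by
      have hc : s.candidate = {⟨s.first, hlt.trans_le hs.upper_le⟩} := by
        rw [← poolSegment_succ]; simp only [he]; rfl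
      rw [hc] at hW hn
      exact hn (satisfiesECCWithin_singleton hW)
    refine ⟨(Nat.sub_le _ _).trans hs.upper_le, hs.found, Or.inr ?_, fun c h1 h2 V hV hE => ?_⟩
    · simp only; omega
    · rcases (Nat.le_of_pred_lt h1).eq_or_lt with rfl | h3
      · exact hn (hE.of_isWaterLevel hV hW)
      · exact hs.rejected c h3 h2 V hV hE
  · refine ⟨le_rfl, ?_, hs.upper_le.eq_or_lt, fun c h1 h2 => absurd h2 h1.not_ge⟩
    exact ConsecutiveEpochs.append_iff.2 ⟨s.first, hs.found,
      .cons ⟨⟨hlt, hs.upper_le, rfl, hW, hy⟩, hs.rejected⟩ (.nil _)⟩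

/-- Lexicographic measure for the termination of the forward search algorithm. -/
def fsaMeasure (s : FSAState J) : ℕ := (J - s.first) * (J + 1) + s.upper

theorem FSAStep.measure_lt {s t : FSAState J} (h : S.FSAStep s t) (hs : S.FSAInvariant s) :
    fsaMeasure t < fsaMeasure s := by
  obtain ⟨hlt, W, hW, ⟨hn, rfl⟩ | ⟨hy, rfl⟩⟩ := h
  · simp only [fsaMeasure]; omega
  · have hle := hs.upper_le
    have h1 : (J - s.upper + 1) * (J + 1) ≤ (J - s.first) * (J + 1) :=
      Nat.mul_le_mul_right _ (by omega)
    simp only [fsaMeasure]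
    rw [Nat.add_mul, Nat.one_mul] at h1
    omega

/-- If the level decreased from one epoch to the next, then their union would satisfy the energy
causality constraints, so the earlier epoch would have been longer. -/
theorem ndaHalted_of_noLongerEpoch [NeZero K] {s : List (Epoch J)} {b : ℕ}
    (h : ConsecutiveEpochs (fun a b e => S.IsEpoch a b e ∧ S.NoLongerEpoch a b) s 0 b) :
    NDAHalted s := by
  rintro l r e f rfl
  obtain ⟨x, -, h⟩ := ConsecutiveEpochs.append_iff.1 h
  obtain ⟨y, he, h⟩ := ConsecutiveEpochs.cons_iff.1 h
  obtain ⟨z, hf, -⟩ := ConsecutiveEpochs.cons_iff.1 h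
  by_contra hlt
  have hne : (e.pools ∪ f.pools).Nonempty := by
    refine ⟨⟨x, he.1.lt.trans_le he.1.le⟩, Finset.mem_union_left _ ?_⟩
    rw [he.1.pools_eq, mem_poolSegment]
    exact ⟨le_rfl, he.1.lt⟩
  obtain ⟨W, hW⟩ := S.exists_isWaterLevel hne
  have hg := he.1.merge hf.1 (not_le.1 hlt) (g := ⟨e.pools ∪ f.pools, W⟩) rfl hW
  exact he.2 z hf.1.lt hf.1.le W (hg.pools_eq ▸ hg.isWaterLevel) (hg.pools_eq ▸ hg.satisfiesECC)

theorem fsa_totallyCorrect [NeZero K] (S : HarvestingSystem K N J) :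
    TotallyCorrect FSAStart S.FSAStep FSAHalted (fun s => S.YieldsOptimum s.found) := by
  refine ⟨⟨_, rfl⟩, fun f h₀ hf => ?_, fun s₀ s h₀ hrun => ?_⟩
  · have hinv : ∀ i, S.FSAInvariant (f i) := fun i => by
      induction i with
      | zero => exact FSAInvariant.of_start h₀
      | succ i ih => exact (hf i).invariant ih
    exact not_forall_succ_lt fsaMeasure f fun i => (hf i).measure_lt (hinv i)
  · have hs : S.FSAInvariant s := by
      induction hrun with
      | refl => exact FSAInvariant.of_start h₀
      | tail _ hstep ih => exact hstep.invariant ih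
    refine ⟨fun hh => ?_, fun hh => ?_⟩
    · have hc := hs.found
      rw [show s.first = J from hh] at hc
      exact yieldsOptimum_of_consecutive (hc.mono fun _ _ _ h => h.1)
        (ndaHalted_of_noLongerEpoch hc)
    · have hlt := hs.first_lt.resolve_left hh
      have hne : s.candidate.Nonempty := by
        refine ⟨⟨s.first, hlt.trans_le hs.upper_le⟩, ?_⟩
        change _ ∈ poolSegment J s.first s.upper
        rw [mem_poolSegment]
        exact ⟨le_rfl, hlt⟩
      obtain ⟨W, hW⟩ := S.exists_isWaterLevel hne
      by_cases hE : S.SatisfiesECCWithin s.candidate W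
      · exact ⟨_, hlt, W, hW, Or.inr ⟨hE, rfl⟩⟩
      · exact ⟨_, hlt, W, hW, Or.inl ⟨hE, rfl⟩⟩

end HarvestingSystem

theorem mainTheorem1 {K N J : ℕ} [NeZero K] [NeZero J] (S : HarvestingSystem K N J) :
    (∀ A : Finset (Fin J), A.Nonempty → ∃ W, S.IsWaterLevel A W) ∧
    TotallyCorrect S.NDAStart S.NDAStep NDAHalted S.YieldsOptimum ∧
    TotallyCorrect FSAStart S.FSAStep FSAHalted (fun s => S.YieldsOptimum s.found) :=
  ⟨fun _ hA => S.exists_isWaterLevel hA, S.nda_totallyCorrect, S.fsa_totallyCorrect⟩
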